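/- Let $F_N$ be the free group on a basis $A_N$ with $N\ge 2$ elements, $\partial F_N$ its boundary (infinite reduced words), and $\partial^2F_N=(\partial F_N\times\partial F_N)\setminus\Delta$. Let $\varphi$ be an automorphism of $F_N$ that is $A_N$-positive (each $\varphi(a)$, $a\in A_N$, is a nonempty word in letters of $A_N$ only) and primitive (for some $k\ge1$, every letter of $A_N$ occurs in $\varphi^k(a)$ for every $a\in A_N$). An automorphism $\psi$ induces homeomorphisms $\partial\psi$ of $\partial F_N$ and $\partial^2\psi$ of $\partial^2F_N$. Let $i_w(u)=w^{-1}uw$ and $\Phi_\infty=\{i_w\circ\varphi^k : w\in F_N,\ k\ge1\}$. Write $u=p*a*s$ if $u=pas$ without cancellation. The shift is $S(X,Y)=(Y_0^{-1}X,Y_0^{-1}Y)$, where $Y_0$ is the first letter of $Y$; its inverse, on pairs with different first letters, is $S^{-1}(X,Y)=(X_0^{-1}X,X_0^{-1}Y)$. The attracting subshift $\Sigma_\varphi$ is the closure in $\partial^2F_N$ of $\{S^n(X,Y): n\in\mathbb Z\}$, where $$X=\lim_n p^{-1}\varphi^k(p^{-1})\cdots\varphi^{nk}(p^{-1}),\qquad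 Y=\lim_n a\,s\,\varphi^k(s)\cdots\varphi^{nk}(s)$$ for a letter $a\in A_N$ and an integer $k$ such that $\varphi^k(a)=p*a*s$ with $p,s$ nonempty and pure positive (this set does not depend on the choices). A prefix-suffix development of $W\in\Sigma_\varphi$ is a sequence $(p_i,a_i,s_i)_{i\ge0}$ in $F_N\times A_N\times F_N$ with $\varphi(a_{i+1})=p_i*a_i*s_i$ for all $i\ge 0$, for which there are points $W=W_0,W_1,W_2,\dots$ of $\Sigma_\varphi$ such that, for all $i$, the second coordinate of $W_i$ begins with $a_i$ and $W_i=p_i^{-1}\,\partial^2\varphi(W_{i+1})$. **Theorem.** 1. Every $W\in\Sigma_\varphi$ has exactly one prefix-suffix development; it is denoted $\rho_\varphi(W)$. 2. If $W\in\Sigma_\varphi$ is a fixed point of $\partial^2\psi$ with $\psi=i_w\circ\varphi^k$, $w\in F_N$, $k\ge1$, then $\rho_\varphi(W)$ is preperiodic (eventually periodic) with a period of length $\le k$. 3. Conversely, if $W\in\Sigma_\varphi$ and $\rho_\varphi(W)$ is eventually constant, then $W$ is a fixed point of $\partial^2\psi$ for some $\psi\in\Phi_\infty$. -/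

import Mathlib

open Filter

namespace FreeGroupDev

/-- Letters of the alphabet `A ∪ A⁻¹`: `(a, true)` is the letter `a`, `(a, false)` is `a⁻¹`. -/
abbrev Letter (N : ℕ) := Fin N × Bool

/-- The free group `F_N` with its standard basis `A_N = {a_0, …, a_{N-1}}`. -/
abbrev F (N : ℕ) := FreeGroup (Fin N)

/-- The boundary `∂F_N`: infinite reduced words in `A_N ∪ A_N⁻¹`. -/
def Boundary (N : ℕ) : Type :=
  {X : ℕ → Letter N // ∀ i, X (i + 1) ≠ ((X i).1, !(X i).2)}

/-- The `i`-th letter `X_i` of a boundary point. -/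
def Boundary.letter {N : ℕ} (X : Boundary N) (i : ℕ) : Letter N := X.1 i

/-- The list of the first `n` letters of a boundary point. -/
def Boundary.letters {N : ℕ} (X : Boundary N) (n : ℕ) : List (Letter N) :=
  (List.range n).map X.1

/-- The prefix of length `n` of a boundary point, as an element of `F_N`. -/
def Boundary.pref {N : ℕ} (X : Boundary N) (n : ℕ) : F N := FreeGroup.mk (X.letters n)

/-- The topology of `∂F_N`: the product topology on sequences of letters, where the finite
alphabet is discrete. -/
instance {N : ℕ} : TopologicalSpace (Boundary N) :=
  TopologicalSpace.induced Subtype.val (@Pi.topologicalSpace ℕ (fun _ => Letter N) (fun _ => ⊥))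

/-- The sequence of words `u n` converges to the boundary point `X` (in `F_N ∪ ∂F_N`): every
prefix of `X` is eventually a prefix of the reduced word `u n`. -/
def IsLimit {N : ℕ} (u : ℕ → F N) (X : Boundary N) : Prop :=
  ∀ m, ∀ᶠ n in atTop, X.letters m <+: (u n).toWord

theorem Boundary.length_letters {N : ℕ} (X : Boundary N) (n : ℕ) :
    (X.letters n).length = n := by simp [Boundary.letters]

theorem Boundary.toWord_pref {N : ℕ} (X : Boundary N) (n : ℕ) :
    (X.pref n).toWord = X.letters n := by
  have h : FreeGroup.IsReduced (X.letters n) := by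
    unfold FreeGroup.IsReduced
    rw [List.isChain_iff_getElem]
    intro i hi h1
    simp only [Boundary.letters, List.getElem_map, List.getElem_range] at h1 ⊢
    by_contra h2
    refine X.2 i (Prod.ext h1.symm ?_)
    revert h2
    cases (X.1 i).2 <;> cases (X.1 (i + 1)).2 <;> simp
  rw [Boundary.pref, FreeGroup.toWord_mk, h.reduce_eq]

theorem Boundary.pref_succ {N : ℕ} (X : Boundary N) (n : ℕ) :
    X.pref (n + 1) = X.pref n * FreeGroup.mk [X.letter n] := by
  simp [Boundary.pref, Boundary.letters, Boundary.letter, List.range_succ]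

theorem Boundary.norm_pref {N : ℕ} (X : Boundary N) (n : ℕ) : (X.pref n).norm = n := by
  rw [FreeGroup.norm, X.toWord_pref, X.length_letters]

/-- The limit of a sequence of words is unique. -/
theorem IsLimit.unique {N : ℕ} {u : ℕ → F N} {X Y : Boundary N}
    (hX : IsLimit u X) (hY : IsLimit u Y) : X = Y := by
  apply Subtype.ext
  funext i
  obtain ⟨n, h1, h2⟩ := ((hX (i + 1)).and (hY (i + 1))).exists
  have h3 : X.letters (i + 1) = Y.letters (i + 1) := by
    rw [List.prefix_iff_eq_take] at h1 h2
    rw [h1, h2, X.length_letters, Y.length_letters]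
  simpa [Boundary.letters] using congrArg (fun l => l[i]?) h3

theorem take_mul_letter {N : ℕ} (u : F N) (x : Letter N) (m : ℕ) (h : m + 1 ≤ u.norm) :
    (u * FreeGroup.mk [x]).toWord.take m = u.toWord.take m := by
  rcases List.eq_nil_or_concat u.toWord with h0 | ⟨w, y, hw⟩
  · simp [FreeGroup.norm, h0] at h
  · have hred : FreeGroup.IsReduced (w ++ [y]) := by
      rw [← List.concat_eq_append, ← hw]; exact FreeGroup.isReduced_toWord
    rw [List.concat_eq_append] at hw
    have hlen : m ≤ w.length := by simp [FreeGroup.norm, hw] at h; omega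
    have hu : u = FreeGroup.mk (w ++ [y]) := by rw [← hw, FreeGroup.mk_toWord]
    by_cases hxy : y.1 = x.1 → y.2 = x.2
    · have hr : FreeGroup.IsReduced ((w ++ [y]) ++ [x]) :=
        FreeGroup.IsReduced.append_overlap hred (by simpa using hxy) (by simp)
      rw [hu, FreeGroup.mul_mk, FreeGroup.toWord_mk, FreeGroup.toWord_mk, hr.reduce_eq,
        hred.reduce_eq, List.take_append_of_le_length (by simp; omega)]
    · have hyx : x = (y.1, !y.2) := by
        push Not at hxy
        refine Prod.ext hxy.1.symm ?_
        have := hxy.2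
        revert this
        cases y.2 <;> cases x.2 <;> simp
      have hmk : u * FreeGroup.mk [x] = FreeGroup.mk w := by
        rw [hu, FreeGroup.mul_mk]
        apply Quot.sound
        rw [hyx]
        have := FreeGroup.Red.Step.not (L₁ := w) (L₂ := []) (x := y.1) (b := y.2)
        simpa using this
      have hrw : FreeGroup.IsReduced w := hred.infix ⟨[], [y], by simp⟩
      rw [hmk, FreeGroup.toWord_mk, hrw.reduce_eq, hw,
        List.take_append_of_le_length hlen]

theorem take_mul_mk {N : ℕ} (l : List (Letter N)) : ∀ (u : F N) (m : ℕ),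
    m + l.length ≤ u.norm → (u * FreeGroup.mk l).toWord.take m = u.toWord.take m := by
  induction l with
  | nil => intro u m _; rw [← FreeGroup.one_eq_mk, mul_one]
  | cons x l ih =>
    intro u m h
    simp only [List.length_cons] at h
    have h1 : (u * FreeGroup.mk (x :: l)) = (u * FreeGroup.mk [x]) * FreeGroup.mk l := by
      rw [mul_assoc, FreeGroup.mul_mk]; rfl
    have h2 : u.norm ≤ (u * FreeGroup.mk [x]).norm + 1 := by
      calc u.norm = ((u * FreeGroup.mk [x]) * (FreeGroup.mk [x])⁻¹).norm := by rw [mul_inv_cancel_right]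
        _ ≤ (u * FreeGroup.mk [x]).norm + ((FreeGroup.mk [x])⁻¹).norm := FreeGroup.norm_mul_le _ _
        _ ≤ _ := by
          rw [FreeGroup.norm_inv_eq]
          have := FreeGroup.norm_mk_le (L₁ := [x])
          simp only [List.length_singleton] at this
          omega
    rw [h1, ih _ m (by omega), take_mul_letter u x m (by omega)]

/-- A sequence of words whose lengths tend to infinity and whose consecutive terms stay at bounded
distance converges to a boundary point. -/
theorem exists_isLimit {N : ℕ} (u : ℕ → F N) (L : ℕ)
    (h1 : Tendsto (fun n => (u n).norm) atTop atTop)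
    (h2 : ∀ n, ((u n)⁻¹ * u (n + 1)).norm ≤ L) : ∃ X, IsLimit u X := by
  have hstab : ∀ m, ∃ n0, ∀ n, n0 ≤ n →
      m + L ≤ (u n).norm ∧ (u n).toWord.take m = (u n0).toWord.take m := by
    intro m
    obtain ⟨n0, hn0⟩ := eventually_atTop.1 (h1.eventually_ge_atTop (m + L))
    refine ⟨n0, fun n hn => ⟨hn0 n hn, ?_⟩⟩
    induction n, hn using Nat.le_induction with
    | base => rfl
    | succ n hn ih =>
      rw [← ih]
      have h3 : u (n + 1) = u n * FreeGroup.mk ((u n)⁻¹ * u (n + 1)).toWord := by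
        rw [FreeGroup.mk_toWord]; group
      rw [h3]
      apply take_mul_mk
      have h4 := hn0 n hn
      have h5 := h2 n
      simp only [FreeGroup.norm] at h4 h5 ⊢
      omega
  choose f hf using hstab
  have hlen : ∀ m n, f m ≤ n → m ≤ (u n).toWord.length := fun m n h => by
    have := (hf m n h).1
    simp only [FreeGroup.norm] at this
    omega
  let Y : ℕ → Letter N := fun i =>
    (u (f (i + 1))).toWord[i]'(by have := hlen (i + 1) _ le_rfl; omega)
  have hY : ∀ i n (h : f (i + 1) ≤ n),
      (u n).toWord[i]'(by have := hlen (i + 1) _ h; omega) = Y i := by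
    intro i n h
    have h3 := (hf (i + 1) n h).2
    have h4 := congrArg (fun l => l[i]?) h3
    have h5 := hlen (i + 1) _ h
    have h6 := hlen (i + 1) _ (le_refl (f (i + 1)))
    rw [List.getElem?_take_of_lt (by omega), List.getElem?_take_of_lt (by omega),
      List.getElem?_eq_getElem (by omega), List.getElem?_eq_getElem (by omega)] at h4
    exact Option.some.inj h4
  refine ⟨⟨Y, ?_⟩, ?_⟩
  · intro i h
    have hr : FreeGroup.IsReduced (u (max (f (i + 1)) (f (i + 2)))).toWord :=
      FreeGroup.isReduced_toWord
    unfold FreeGroup.IsReduced at hr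
    rw [List.isChain_iff_getElem] at hr
    have h5 := hlen (i + 2) _ (le_max_right (f (i + 1)) (f (i + 2)))
    have h6 := hr i (by omega)
    rw [hY i _ (le_max_left _ _), hY (i + 1) _ (le_max_right _ _), h] at h6
    simp at h6
  · intro m
    have h3 : ∀ᶠ n in atTop, ∀ i ∈ Finset.range (m + 1), f i ≤ n :=
      (Finset.eventually_all (Finset.range (m + 1))).2 fun i _ => eventually_ge_atTop (f i)
    filter_upwards [h3] with n hn
    rw [List.prefix_iff_eq_take]
    have h4 := hlen m n (hn m (by simp))
    apply List.ext_getElem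
    · simp [Boundary.letters, h4]
    · intro i h5 h6
      have h7 : i < m := by simpa [Boundary.letters] using h5
      simp only [Boundary.letters, List.getElem_map, List.getElem_range, List.getElem_take]
      exact (hY i n (hn (i + 1) (by simp; omega))).symm

theorem norm_hom_le {N : ℕ} (χ : F N →* F N) : ∃ C : ℕ, ∀ u : F N, (χ u).norm ≤ C * u.norm := by
  let C : ℕ := ∑ a : Fin N, (χ (FreeGroup.of a)).norm
  have hC : ∀ x : Letter N, (χ (FreeGroup.mk [x])).norm ≤ C := by
    rintro ⟨a, b⟩
    have h1 : (χ (FreeGroup.of a)).norm ≤ C :=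
      Finset.single_le_sum (f := fun a : Fin N => (χ (FreeGroup.of a)).norm)
        (fun _ _ => Nat.zero_le _) (Finset.mem_univ a)
    cases b with
    | true => exact h1
    | false =>
      have h2 : (FreeGroup.mk [(a, false)] : F N) = (FreeGroup.of a)⁻¹ := by
        simp [FreeGroup.of, FreeGroup.invRev]
      rw [h2, map_inv, FreeGroup.norm_inv_eq]
      exact h1
  have hl : ∀ l : List (Letter N), (χ (FreeGroup.mk l)).norm ≤ C * l.length := by
    intro l
    induction l with
    | nil => rw [← FreeGroup.one_eq_mk]; simp
    | cons x l ih =>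
      have h1 : (FreeGroup.mk (x :: l) : F N) = FreeGroup.mk [x] * FreeGroup.mk l := by
        rw [FreeGroup.mul_mk]; rfl
      rw [h1, map_mul]
      have h2 := FreeGroup.norm_mul_le (χ (FreeGroup.mk [x])) (χ (FreeGroup.mk l))
      have h3 := hC x
      rw [List.length_cons, Nat.mul_succ]
      omega
  refine ⟨C, fun u => ?_⟩
  have := hl u.toWord
  rwa [FreeGroup.mk_toWord] at this

theorem norm_letter_le {N : ℕ} (x : Letter N) : (FreeGroup.mk [x] : F N).norm ≤ 1 := by
  simpa using FreeGroup.norm_mk_le (L₁ := [x])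

theorem exists_smul {N : ℕ} (g : F N) (X : Boundary N) :
    ∃ Y, IsLimit (fun n => g * X.pref n) Y := by
  refine exists_isLimit _ 1 ?_ ?_
  · refine tendsto_atTop_mono (f := fun n => n - g.norm) (fun n => ?_) (tendsto_sub_atTop_nat _)
    have h1 := FreeGroup.norm_mul_le g⁻¹ (g * X.pref n)
    rw [inv_mul_cancel_left, X.norm_pref, FreeGroup.norm_inv_eq] at h1
    omega
  · intro n
    have h1 : (g * X.pref n)⁻¹ * (g * X.pref (n + 1)) = FreeGroup.mk [X.letter n] := by
      rw [X.pref_succ]; group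
    rw [h1]
    exact norm_letter_le _

theorem exists_boundaryMap {N : ℕ} (ψ : MulAut (F N)) (X : Boundary N) :
    ∃ Y, IsLimit (fun n => ψ (X.pref n)) Y := by
  obtain ⟨C, hC⟩ := norm_hom_le (ψ : MulAut (F N)).toMonoidHom
  obtain ⟨C', hC'⟩ := norm_hom_le (ψ⁻¹ : MulAut (F N)).toMonoidHom
  refine exists_isLimit _ C ?_ ?_
  · refine tendsto_atTop.2 fun b => ?_
    filter_upwards [eventually_ge_atTop (C' * b + 1)] with n hn
    have h1 := hC' (ψ (X.pref n))
    have h2 : (ψ⁻¹ : MulAut (F N)).toMonoidHom (ψ (X.pref n)) = X.pref n :=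
      MulAut.inv_apply_self (F N) ψ (X.pref n)
    rw [h2, X.norm_pref] at h1
    by_contra h3
    have h4 : C' * (ψ (X.pref n)).norm ≤ C' * b := Nat.mul_le_mul_left _ (by omega)
    omega
  · intro n
    have h1 : (ψ (X.pref n))⁻¹ * ψ (X.pref (n + 1)) = ψ (FreeGroup.mk [X.letter n]) := by
      rw [X.pref_succ, map_mul, inv_mul_cancel_left]
    rw [h1]
    have h2 := hC (FreeGroup.mk [X.letter n])
    have h3 := Nat.mul_le_mul_left C (norm_letter_le (X.letter n))
    calc _ ≤ _ := h2
      _ ≤ _ := h3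
      _ = C := by simp

/-- The action of `F_N` on its boundary by left translation: `g X` is the limit of `g X_0 … X_n`. -/
noncomputable def translate {N : ℕ} (g : F N) (X : Boundary N) : Boundary N :=
  (exists_smul g X).choose

/-- The map `∂ψ` of the boundary induced by an automorphism `ψ`: `∂ψ(X)` is the limit of
`ψ(X_0 … X_n)`. -/
noncomputable def boundaryMap {N : ℕ} (ψ : MulAut (F N)) (X : Boundary N) : Boundary N :=
  (exists_boundaryMap ψ X).choose

theorem translate_spec {N : ℕ} (g : F N) (X : Boundary N) :
    IsLimit (fun n => g * X.pref n) (translate g X) := (exists_smul g X).choose_spec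

theorem boundaryMap_spec {N : ℕ} (ψ : MulAut (F N)) (X : Boundary N) :
    IsLimit (fun n => ψ (X.pref n)) (boundaryMap ψ X) := (exists_boundaryMap ψ X).choose_spec

/-- The double boundary `∂²F_N = (∂F_N × ∂F_N) ∖ Δ`, as a subset of `∂F_N × ∂F_N`. -/
def doubleBoundary (N : ℕ) : Set (Boundary N × Boundary N) := {Z | Z.1 ≠ Z.2}

/-- The diagonal action of `F_N` on pairs of boundary points. -/
noncomputable def translate₂ {N : ℕ} (g : F N) (Z : Boundary N × Boundary N) :
    Boundary N × Boundary N := (translate g Z.1, translate g Z.2)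

/-- The map `∂²ψ` induced by an automorphism `ψ` on pairs of boundary points. -/
noncomputable def boundaryMap₂ {N : ℕ} (ψ : MulAut (F N)) (Z : Boundary N × Boundary N) :
    Boundary N × Boundary N := (boundaryMap ψ Z.1, boundaryMap ψ Z.2)

/-- The shift map `S (X, Y) = (Y_0⁻¹ X, Y_0⁻¹ Y)`. -/
noncomputable def shift {N : ℕ} (Z : Boundary N × Boundary N) : Boundary N × Boundary N :=
  translate₂ (FreeGroup.mk [Z.2.letter 0])⁻¹ Z

/-- The inverse shift `(X, Y) ↦ (X_0⁻¹ X, X_0⁻¹ Y)`. On the pairs with `X_0 ≠ Y_0` (those whose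
geodesic passes through the identity), `shift` is a bijection and this is its inverse. -/
noncomputable def shiftInv {N : ℕ} (Z : Boundary N × Boundary N) : Boundary N × Boundary N :=
  translate₂ (FreeGroup.mk [Z.1.letter 0])⁻¹ Z

/-- The powers `S^n`, `n ∈ ℤ`, of the shift. -/
noncomputable def shiftZ {N : ℕ} : ℤ → Boundary N × Boundary N → Boundary N × Boundary N
  | Int.ofNat n => shift^[n]
  | Int.negSucc n => shiftInv^[n + 1]

/-- A word is pure positive if it is not empty and all its letters are in `A_N`. -/
def PurePositive {N : ℕ} (u : F N) : Prop := u ≠ 1 ∧ ∀ x ∈ u.toWord, x.2 = true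

/-- An automorphism is `A_N`-positive if it maps every letter of `A_N` to a pure positive word. -/
def IsPositive {N : ℕ} (φ : MulAut (F N)) : Prop := ∀ a, PurePositive (φ (FreeGroup.of a))

/-- Some positive power of `φ` maps every letter of `A_N` to a word containing all the letters of
`A_N`. -/
def IsPrimitive {N : ℕ} (φ : MulAut (F N)) : Prop :=
  ∃ k : ℕ, 1 ≤ k ∧ ∀ a b : Fin N, (b, true) ∈ ((φ ^ k) (FreeGroup.of a)).toWord

/-- `v = p * a * s`, where the product is free of cancellations. -/
def IsCut {N : ℕ} (v p : F N) (a : Fin N) (s : F N) : Prop :=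
  v.toWord = p.toWord ++ (a, true) :: s.toWord

/-- `(X, Y)` is the pair of limits
`X = lim p⁻¹ φ^k(p⁻¹) ⋯ φ^{nk}(p⁻¹)` and `Y = lim a s φ^k(s) ⋯ φ^{nk}(s)`
for a letter `a` and some `k` with `φ^k(a) = p * a * s`, `p` and `s` not empty. -/
def IsSeed {N : ℕ} (φ : MulAut (F N)) (Z : Boundary N × Boundary N) : Prop :=
  ∃ (a : Fin N) (k : ℕ) (p s : F N), PurePositive p ∧ PurePositive s ∧
    IsCut ((φ ^ k) (FreeGroup.of a)) p a s ∧
    IsLimit (fun n => ((List.range (n + 1)).map fun i => (φ ^ (i * k)) p⁻¹).prod) Z.1 ∧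
    IsLimit (fun n =>
      FreeGroup.of a * ((List.range (n + 1)).map fun i => (φ ^ (i * k)) s).prod) Z.2

/-- The attracting subshift `Σ_φ`: the closure in `∂²F_N` of the `S`-orbit of a point `(X, Y)` as
in `IsSeed`. It does not depend on the choice of the point, and is written here as the union over
all choices. -/
def attractingSubshift {N : ℕ} (φ : MulAut (F N)) : Set (Boundary N × Boundary N) :=
  {W | W ∈ doubleBoundary N ∧
    ∃ Z, IsSeed φ Z ∧ W ∈ closure (Set.range fun n : ℤ => shiftZ n Z)}

/-- Labels `(p, a, s)` of the prefix-suffix automaton. -/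
structure Label (N : ℕ) where
  /-- the prefix -/
  p : F N
  /-- the letter -/
  a : Fin N
  /-- the suffix -/
  s : F N

/-- The set `D` of admissible developments: sequences of labels of infinite walks in the
prefix-suffix automaton, which has an edge labelled `(p, a, s)` from `a` to `b` if and only if
`φ(b) = p * a * s`. -/
def admissible {N : ℕ} (φ : MulAut (F N)) : Set (ℕ → Label N) :=
  {d | ∀ n, IsCut (φ (FreeGroup.of (d (n + 1)).a)) (d n).p (d n).a (d n).s}

/-- `d = (p_i, a_i, s_i)_i` is obtained from `W ∈ Σ_φ` by iterated desubstitution: `d ∈ D`, and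
there are points `W = W_0, W_1, W_2, …` of `Σ_φ` such that the second coordinate of `W_i` starts
with the letter `a_i` and `W_i = p_i⁻¹ ∂²φ(W_{i+1})`, i.e. `W_i = S^{|p_i|} ∂²φ(W_{i+1})`. -/
def IsDevelopment {N : ℕ} (φ : MulAut (F N)) (W : Boundary N × Boundary N)
    (d : ℕ → Label N) : Prop :=
  d ∈ admissible φ ∧ ∃ Z : ℕ → Boundary N × Boundary N, Z 0 = W ∧ ∀ i,
    Z i ∈ attractingSubshift φ ∧ (Z i).2.letter 0 = ((d i).a, true) ∧
    Z i = translate₂ (d i).p⁻¹ (boundaryMap₂ φ (Z (i + 1)))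

open Classical in
/-- The prefix-suffix development map `ρ_φ`. The value where no development exists is
irrelevant: every point of `Σ_φ` has exactly one. -/
noncomputable def development {N : ℕ} (φ : MulAut (F N)) (W : Boundary N × Boundary N) :
    ℕ → Label N :=
  if h : ∃ d, IsDevelopment φ W d then h.choose else fun _ => ⟨1, (W.2.letter 0).1, 1⟩

/-- The inner automorphism `i_w : u ↦ w⁻¹ u w`. -/
def innerAut {N : ℕ} (w : F N) : MulAut (F N) := MulAut.conj w⁻¹

/-- The set `Φ_∞ = {i_w ∘ φ^k ; w ∈ F_N, k ≥ 1}`. -/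
def outerPowers {N : ℕ} (φ : MulAut (F N)) : Set (MulAut (F N)) :=
  {ψ | ∃ (w : F N) (k : ℕ), 1 ≤ k ∧ ψ = innerAut w * φ ^ k}

/-- The sequence `d` is preperiodic (eventually periodic) with a period of length `ℓ`. -/
def IsPreperiodic {N : ℕ} (d : ℕ → Label N) (ℓ : ℕ) : Prop :=
  1 ≤ ℓ ∧ ∃ n, ∀ i, n ≤ i → d (i + ℓ) = d i

/-- The sequence `d` is eventually constant. -/
def IsEventuallyConstant {N : ℕ} (d : ℕ → Label N) : Prop :=
  ∃ (n : ℕ) (c : Label N), ∀ i, n ≤ i → d i = c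

end FreeGroupDev

namespace FreeGroupDev

/-! ### Limits in `F_N ∪ ∂F_N` -/

/-! A seed is the limit of the words `φ^{nk}(a)`, cut at an inner letter. So every point of Σ_φ is
the pair of ends of a bi-infinite positive word, and once a seed exists Σ_φ consists of the words
all of whose factors occur in some `φ^k(a)` (`exists_languageShift_of_mem`,
`ends_mem_attractingSubshift`). Desubstitutions then exist by compactness: every window of such a
word lies in the image of a word of the language, and a limit over growing windows desubstitutes the
whole word (`exists_isImageAt`).

Uniqueness needs no recognizability theorem, because φ is invertible. If a translation carries one
positive geodesic to another, it moves positions by exactly its exponent sum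
(`translate₂_ends_eq_iff`). If two words differ by a translation `g`, their desubstitutions differ
by `g₁` with `φ(g₁) = p' g p⁻¹`. Comparing exponent sums shows that passing from `g` to `g₁`
consumes at least the lengths of a suffix of one word and a prefix of the other
(`IsPositive.exists_desubstitution_translate`). For `g = 1` this forces `g₁ = 1`.

The same estimate gives periodicity. If `i_w ∘ φ^k` fixes `W`, then `W` and its `k`-th
desubstitution lie in one `F_N`-orbit. Under further desubstitution their displacement either
reaches 0, so that the two chains merge and the development has period `k`, or becomes constant and
nonzero. In the latter case all late prefixes and suffixes are empty, against the growth of `φ^t`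
(`IsDesubstitution.eventually_eq_or`, `IsDesubstitution.not_eventually_eq_one`).

Conversely, a constant development determines a word up to the letters next to the origin along the
chain. There are finitely many such pairs of letters, so two terms `W_m`, `W_{m+K}` of the chain
coincide (`IsDesubstitution.eq_of_const`). Then `∂²(φ^K)` fixes `W_m` up to translation, hence also
`W`. -/

theorem toWord_letter_mul {N : ℕ} (x : Letter N) (u : F N) :
    (FreeGroup.mk [x] * u).toWord =
      List.casesOn u.toWord [x] fun y l => if x.1 = y.1 ∧ x.2 = !y.2 then l else x :: y :: l := by
  conv_lhs => rw [← FreeGroup.mk_toWord (x := u), FreeGroup.mul_mk, FreeGroup.toWord_mk]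
  rw [List.singleton_append, FreeGroup.reduce.cons, FreeGroup.reduce_toWord]

/-- Left multiplication by a letter prepends it or cancels one letter, so it costs at most one
letter of agreement. -/
theorem take_letter_mul {N : ℕ} (x : Letter N) {u v : F N} {m : ℕ}
    (h : u.toWord.take (m + 1) = v.toWord.take (m + 1)) :
    (FreeGroup.mk [x] * u).toWord.take m = (FreeGroup.mk [x] * v).toWord.take m := by
  rw [toWord_letter_mul, toWord_letter_mul]
  rcases hu : u.toWord with _ | ⟨y, l⟩ <;> rcases hv : v.toWord with _ | ⟨z, l'⟩ <;>
    rw [hu, hv] at h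
  · simp at h
  · simp at h
  · simp only [List.take_succ_cons, List.cons.injEq] at h
    obtain ⟨rfl, h⟩ := h
    dsimp only
    split_ifs with hx
    · exact h
    · rcases m with _ | _ | m
      · rfl
      · rfl
      · have h2 := congrArg (List.take m) h
        simp only [List.take_take] at h2
        rw [min_eq_left (by omega)] at h2
        simp [h2]

theorem take_mk_mul {N : ℕ} (l : List (Letter N)) {u v : F N} {m : ℕ}
    (h : u.toWord.take (m + l.length) = v.toWord.take (m + l.length)) :
    (FreeGroup.mk l * u).toWord.take m = (FreeGroup.mk l * v).toWord.take m := by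
  induction l generalizing m with
  | nil => simpa [← FreeGroup.one_eq_mk] using h
  | cons x l ih =>
    have h1 : ∀ w : F N, FreeGroup.mk (x :: l) * w = FreeGroup.mk [x] * (FreeGroup.mk l * w) := by
      intro w
      rw [← mul_assoc, FreeGroup.mul_mk]
      rfl
    rw [h1, h1]
    apply take_letter_mul
    apply ih
    rw [show m + 1 + l.length = m + (x :: l).length by simp; omega]
    exact h

theorem isLimit_iff_take {N : ℕ} {u : ℕ → F N} {X : Boundary N} :
    IsLimit u X ↔ ∀ m, ∀ᶠ n in atTop, (u n).toWord.take m = X.letters m := by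
  unfold IsLimit
  simp only [List.prefix_iff_eq_take, X.length_letters, eq_comm]

theorem isLimit_pref {N : ℕ} (X : Boundary N) : IsLimit X.pref X := by
  rw [isLimit_iff_take]
  intro m
  filter_upwards [eventually_ge_atTop m] with n hn
  rw [X.toWord_pref, Boundary.letters, Boundary.letters, ← List.map_take, List.take_range,
    min_eq_left hn]

theorem IsLimit.comp {N : ℕ} {u : ℕ → F N} {X : Boundary N} (h : IsLimit u X) {f : ℕ → ℕ}
    (hf : Tendsto f atTop atTop) : IsLimit (u ∘ f) X :=
  fun m => hf.eventually (h m)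

theorem IsLimit.congr' {N : ℕ} {u v : ℕ → F N} {X : Boundary N} (h : IsLimit u X)
    (huv : ∀ᶠ n in atTop, u n = v n) : IsLimit v X := by
  intro m
  filter_upwards [h m, huv] with n h1 h2
  rwa [← h2]

/-- Continuity of the action at the boundary: `translate` is specified along the prefixes of `X`
only, and this extends it to any sequence converging to `X`. -/
theorem IsLimit.mul_left {N : ℕ} {u : ℕ → F N} {X : Boundary N} (h : IsLimit u X) (g : F N) :
    IsLimit (fun n => g * u n) (translate g X) := by
  rw [isLimit_iff_take]
  intro m
  have h1 := isLimit_iff_take.1 (translate_spec g X) m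
  have h2 := isLimit_iff_take.1 h (m + g.toWord.length)
  have h3 := isLimit_iff_take.1 (isLimit_pref X) (m + g.toWord.length)
  filter_upwards [h1, h2, h3] with n h1 h2 h3
  rw [← h1]
  have := take_mk_mul g.toWord (h2.trans h3.symm)
  rwa [FreeGroup.mk_toWord] at this

theorem IsLimit.mul_right {N : ℕ} {u : ℕ → F N} {X : Boundary N} (h : IsLimit u X) (g : F N) :
    IsLimit (fun n => u n * g) X := by
  rw [isLimit_iff_take] at *
  intro m
  filter_upwards [h m, h (m + g.toWord.length)] with n h1 h2
  rw [← h1]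
  have := take_mul_mk g.toWord (u n) m ?_
  · rwa [FreeGroup.mk_toWord] at this
  · have h3 := congrArg List.length h2
    rw [X.length_letters, List.length_take] at h3
    rw [FreeGroup.norm]
    omega

theorem IsLimit.translate_eq {N : ℕ} {u : ℕ → F N} {X Y : Boundary N} {g : F N}
    (h : IsLimit u X) (h' : IsLimit (fun n => g * u n) Y) : translate g X = Y :=
  (h.mul_left g).unique h'

theorem translate_mul {N : ℕ} (g h : F N) (X : Boundary N) :
    translate (g * h) X = translate g (translate h X) :=
  ((isLimit_pref X).mul_left (g * h)).unique <| by
    simpa only [mul_assoc] using ((isLimit_pref X).mul_left h).mul_left g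

theorem translate_one {N : ℕ} (X : Boundary N) : translate 1 X = X :=
  (isLimit_pref X).translate_eq (by simpa using isLimit_pref X)

theorem Boundary.letters_succ {N : ℕ} (X : Boundary N) (n : ℕ) :
    X.letters (n + 1) = X.letter 0 :: (List.range n).map fun i => X.letter (i + 1) := by
  simp [Boundary.letters, Boundary.letter, List.range_succ_eq_map, Function.comp_def]

theorem exists_pref_letter_mul {N : ℕ} (x : Letter N) (X : Boundary N) :
    ∃ (Y : Boundary N) (c c' : ℕ), ∀ n, Y.pref (n + c) = FreeGroup.mk [x] * X.pref (n + c') := by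
  by_cases h : X.letter 0 = (x.1, !x.2)
  · refine ⟨⟨fun i => X.1 (i + 1), fun i => X.2 (i + 1)⟩, 0, 1, fun n => ?_⟩
    have h1 : (FreeGroup.mk [x] : F N) = (FreeGroup.mk [X.letter 0])⁻¹ := by
      rw [h]; simp [FreeGroup.invRev]
    have h2 : X.pref (n + 1) = FreeGroup.mk [X.letter 0] *
        FreeGroup.mk ((List.range n).map fun i => X.letter (i + 1)) := by
      rw [FreeGroup.mul_mk, Boundary.pref, X.letters_succ]; rfl
    rw [h1, h2, inv_mul_cancel_left]
    rfl
  · let f : ℕ → Letter N := fun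
      | 0 => x
      | i + 1 => X.letter i
    have hf : ∀ i, f (i + 1) ≠ ((f i).1, !(f i).2) := by
      rintro (_ | i)
      · exact h
      · exact X.2 i
    let Y : Boundary N := ⟨f, hf⟩
    refine ⟨Y, 1, 0, fun n => ?_⟩
    have h1 : Y.letters (n + 1) = x :: X.letters n := Y.letters_succ n
    rw [Boundary.pref, h1, Boundary.pref, FreeGroup.mul_mk]
    rfl

/-- Only finitely many letters cancel, after which the prefixes of `gX` are exactly `g` times those
of `X`. An equality of group elements, unlike mere convergence, can be fed to any automorphism; this
gives equivariance of `boundaryMap` without proving its continuity. -/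
theorem exists_pref_translate {N : ℕ} (g : F N) (X : Boundary N) :
    ∃ c c' : ℕ, ∀ n, (translate g X).pref (n + c) = g * X.pref (n + c') := by
  suffices h : ∀ l : List (Letter N), ∃ (Y : Boundary N) (c c' : ℕ),
      ∀ n, Y.pref (n + c) = FreeGroup.mk l * X.pref (n + c') by
    obtain ⟨Y, c, c', hY⟩ := h g.toWord
    rw [FreeGroup.mk_toWord] at hY
    have h1 : translate g X = Y := by
      refine ((isLimit_pref X).comp (tendsto_add_atTop_nat c')).translate_eq ?_
      simp only [Function.comp_apply, ← hY]
      exact (isLimit_pref Y).comp (tendsto_add_atTop_nat c)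
    exact ⟨c, c', h1 ▸ hY⟩
  intro l
  induction l with
  | nil => exact ⟨X, 0, 0, fun n => by rw [← FreeGroup.one_eq_mk, one_mul]⟩
  | cons x l ih =>
    obtain ⟨Y, c, c', hY⟩ := ih
    obtain ⟨Z, e, e', hZ⟩ := exists_pref_letter_mul x Y
    refine ⟨Z, e + c, e' + c', fun n => ?_⟩
    have h1 : (FreeGroup.mk (x :: l) : F N) = FreeGroup.mk [x] * FreeGroup.mk l := by
      rw [FreeGroup.mul_mk]; rfl
    rw [h1, mul_assoc, show n + (e' + c') = n + e' + c' by omega, ← hY,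
      show n + (e + c) = n + c + e by omega, hZ, show n + c + e' = n + e' + c by omega]

theorem boundaryMap_translate {N : ℕ} (ψ : MulAut (F N)) (g : F N) (X : Boundary N) :
    boundaryMap ψ (translate g X) = translate (ψ g) (boundaryMap ψ X) := by
  obtain ⟨c, c', h⟩ := exists_pref_translate g X
  have h1 := (boundaryMap_spec ψ (translate g X)).comp (tendsto_add_atTop_nat c)
  have h2 := ((boundaryMap_spec ψ X).comp (tendsto_add_atTop_nat c')).mul_left (ψ g)
  refine h1.unique (h2.congr' (Eventually.of_forall fun n => ?_))
  simp [h]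

/-- In `w⁻¹ ψ(u) w` the right factor is bounded and disappears in the limit. -/
theorem boundaryMap_innerAut_mul {N : ℕ} (w : F N) (ψ : MulAut (F N)) (X : Boundary N) :
    boundaryMap (innerAut w * ψ) X = translate w⁻¹ (boundaryMap ψ X) := by
  refine (boundaryMap_spec _ X).unique
    ((((boundaryMap_spec ψ X).mul_right w).mul_left w⁻¹).congr' (Eventually.of_forall fun n => ?_))
  simp [innerAut, mul_assoc]

theorem translate₂_mul {N : ℕ} (g h : F N) (Z : Boundary N × Boundary N) :
    translate₂ (g * h) Z = translate₂ g (translate₂ h Z) := by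
  simp [translate₂, translate_mul]

theorem translate₂_one {N : ℕ} (Z : Boundary N × Boundary N) : translate₂ 1 Z = Z := by
  simp [translate₂, translate_one]

theorem translate₂_inv_eq_iff {N : ℕ} (g : F N) (Z Z' : Boundary N × Boundary N) :
    translate₂ g⁻¹ Z = Z' ↔ Z = translate₂ g Z' := by
  constructor
  · rintro rfl
    rw [← translate₂_mul, mul_inv_cancel, translate₂_one]
  · rintro rfl
    rw [← translate₂_mul, inv_mul_cancel, translate₂_one]

theorem boundaryMap₂_translate₂ {N : ℕ} (ψ : MulAut (F N)) (g : F N)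
    (Z : Boundary N × Boundary N) :
    boundaryMap₂ ψ (translate₂ g Z) = translate₂ (ψ g) (boundaryMap₂ ψ Z) := by
  simp [boundaryMap₂, translate₂, boundaryMap_translate]

theorem boundaryMap₂_innerAut_mul {N : ℕ} (w : F N) (ψ : MulAut (F N))
    (Z : Boundary N × Boundary N) :
    boundaryMap₂ (innerAut w * ψ) Z = translate₂ w⁻¹ (boundaryMap₂ ψ Z) := by
  simp [boundaryMap₂, translate₂, boundaryMap_innerAut_mul]

/-- A limit of words each of which is a prefix of the next ones contains all of them. -/
theorem IsLimit.eq_pref {N : ℕ} {u : ℕ → F N} {X : Boundary N} (h : IsLimit u X)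
    (hu : ∀ m n, m ≤ n → (u m).toWord <+: (u n).toWord) (n : ℕ) : u n = X.pref (u n).norm := by
  obtain ⟨k, hk, hnk⟩ := ((h (u n).norm).and (eventually_ge_atTop n)).exists
  apply FreeGroup.toWord_injective
  rw [X.toWord_pref]
  refine List.IsPrefix.eq_of_length (List.prefix_of_prefix_length_le (hu n k hnk) hk ?_) ?_ <;>
    simp [X.length_letters, FreeGroup.norm]

/-! ### Positive words and exponent sums -/

/-- The element of `F_N` given by a word in the letters of `A_N`. -/
def posWord {N : ℕ} (l : List (Fin N)) : F N := FreeGroup.mk (l.map fun a => (a, true))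

theorem toWord_posWord {N : ℕ} (l : List (Fin N)) :
    (posWord l).toWord = l.map fun a => (a, true) := by
  rw [posWord, FreeGroup.toWord_mk]
  refine FreeGroup.IsReduced.reduce_eq ?_
  unfold FreeGroup.IsReduced
  rw [List.isChain_iff_getElem]
  simp

theorem posWord_injective {N : ℕ} : Function.Injective (posWord : List (Fin N) → F N) := by
  intro l l' h
  have h1 := congrArg FreeGroup.toWord h
  rw [toWord_posWord, toWord_posWord] at h1
  exact List.map_injective_iff.2 (fun a b hab => congrArg Prod.fst hab) h1

theorem posWord_append {N : ℕ} (l l' : List (Fin N)) :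
    posWord (l ++ l') = posWord l * posWord l' := by
  simp [posWord, FreeGroup.mul_mk]

theorem posWord_nil {N : ℕ} : (posWord [] : F N) = 1 := rfl

theorem posWord_singleton {N : ℕ} (a : Fin N) : posWord [a] = FreeGroup.of a := rfl

theorem norm_posWord {N : ℕ} (l : List (Fin N)) : (posWord l).norm = l.length := by
  simp [FreeGroup.norm, toWord_posWord]

theorem eq_posWord {N : ℕ} {u : F N} (h : ∀ x ∈ u.toWord, x.2 = true) :
    u = posWord (u.toWord.map Prod.fst) := by
  apply FreeGroup.toWord_injective
  rw [toWord_posWord, List.map_map]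
  conv_lhs => rw [← List.map_id u.toWord]
  exact List.map_congr_left fun x hx => Prod.ext rfl (h x hx)

/-- The exponent sum of an element of `F_N`. -/
def expSum {N : ℕ} (g : F N) : ℤ :=
  Multiplicative.toAdd (FreeGroup.lift (fun _ : Fin N => Multiplicative.ofAdd (1 : ℤ)) g)

@[simp] theorem expSum_one {N : ℕ} : expSum (1 : F N) = 0 := by simp [expSum]

@[simp] theorem expSum_mul {N : ℕ} (g h : F N) : expSum (g * h) = expSum g + expSum h := by
  simp [expSum]

@[simp] theorem expSum_inv {N : ℕ} (g : F N) : expSum g⁻¹ = -expSum g := by simp [expSum]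

@[simp] theorem expSum_of {N : ℕ} (a : Fin N) : expSum (FreeGroup.of a) = 1 := by simp [expSum]

@[simp] theorem expSum_posWord {N : ℕ} (l : List (Fin N)) : expSum (posWord l) = l.length := by
  induction l with
  | nil => simp [posWord_nil]
  | cons a l ih =>
    rw [← List.singleton_append, posWord_append, expSum_mul, ih, posWord_singleton]
    simp [add_comm]

/-- The word of the image of a letter. -/
def image {N : ℕ} (ψ : MulAut (F N)) (a : Fin N) : List (Fin N) :=
  (ψ (FreeGroup.of a)).toWord.map Prod.fst

theorem IsPositive.apply_of {N : ℕ} {ψ : MulAut (F N)} (h : IsPositive ψ) (a : Fin N) :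
    ψ (FreeGroup.of a) = posWord (image ψ a) := eq_posWord (h a).2

theorem IsPositive.apply_posWord {N : ℕ} {ψ : MulAut (F N)} (h : IsPositive ψ)
    (l : List (Fin N)) : ψ (posWord l) = posWord (l.flatMap (image ψ)) := by
  induction l with
  | nil => simp [posWord_nil]
  | cons a l ih =>
    rw [← List.singleton_append, posWord_append, map_mul, ih, posWord_singleton, h.apply_of,
      List.flatMap_append, posWord_append, List.flatMap_singleton]

theorem IsPositive.image_length_pos {N : ℕ} {ψ : MulAut (F N)} (h : IsPositive ψ) (a : Fin N) :
    0 < (image ψ a).length := by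
  rw [List.length_pos_iff]
  intro h1
  apply (h a).1
  rw [h.apply_of, h1, posWord_nil]

theorem IsPositive.length_le_flatMap {N : ℕ} {ψ : MulAut (F N)} (h : IsPositive ψ)
    (l : List (Fin N)) : l.length ≤ (l.flatMap (image ψ)).length := by
  induction l with
  | nil => simp
  | cons a l ih =>
    have := h.image_length_pos a
    simp only [List.flatMap_cons, List.length_append, List.length_cons]
    omega

theorem isPositive_of_apply_of {N : ℕ} {ψ : MulAut (F N)} {f : Fin N → List (Fin N)}
    (h : ∀ a, f a ≠ []) (h' : ∀ a, ψ (FreeGroup.of a) = posWord (f a)) : IsPositive ψ := by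
  intro a
  rw [PurePositive, h' a]
  constructor
  · rw [← posWord_nil]
    exact fun h1 => h a (posWord_injective h1)
  · simp [toWord_posWord]

theorem isPositive_one {N : ℕ} : IsPositive (1 : MulAut (F N)) :=
  isPositive_of_apply_of (f := fun a => [a]) (by simp) fun a => by simp [posWord_singleton]

theorem image_one {N : ℕ} (a : Fin N) : image (1 : MulAut (F N)) a = [a] := by simp [image]

theorem IsPositive.mul_apply_of {N : ℕ} {φ ψ : MulAut (F N)} (hφ : IsPositive φ)
    (hψ : IsPositive ψ) (a : Fin N) :
    (φ * ψ) (FreeGroup.of a) = posWord ((image ψ a).flatMap (image φ)) := by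
  rw [MulAut.mul_apply, hψ.apply_of, hφ.apply_posWord]

theorem IsPositive.image_mul {N : ℕ} {φ ψ : MulAut (F N)} (hφ : IsPositive φ)
    (hψ : IsPositive ψ) (a : Fin N) : image (φ * ψ) a = (image ψ a).flatMap (image φ) := by
  rw [image, hφ.mul_apply_of hψ, toWord_posWord, List.map_map]
  exact List.map_id _

theorem IsPositive.mul {N : ℕ} {φ ψ : MulAut (F N)} (hφ : IsPositive φ) (hψ : IsPositive ψ) :
    IsPositive (φ * ψ) := by
  refine isPositive_of_apply_of (fun a h => ?_) (hφ.mul_apply_of hψ)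
  have h1 := hφ.length_le_flatMap (image ψ a)
  have h2 := hψ.image_length_pos a
  rw [h, List.length_nil] at h1
  omega

theorem IsPositive.pow {N : ℕ} {φ : MulAut (F N)} (h : IsPositive φ) (n : ℕ) :
    IsPositive (φ ^ n) := by
  induction n with
  | zero => simpa using isPositive_one
  | succ n ih => rw [pow_succ]; exact ih.mul h

/-! ### Bi-infinite words -/

/-- The factor of length `n` at position `i` of a bi-infinite word. -/
def factor {N : ℕ} (w : ℤ → Fin N) (i : ℤ) (n : ℕ) : List (Fin N) :=
  (List.range n).map fun j : ℕ => w (i + j)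

@[simp] theorem length_factor {N : ℕ} (w : ℤ → Fin N) (i : ℤ) (n : ℕ) :
    (factor w i n).length = n := by simp [factor]

theorem factor_add {N : ℕ} (w : ℤ → Fin N) (i : ℤ) (m n : ℕ) :
    factor w i (m + n) = factor w i m ++ factor w (i + m) n := by
  simp [factor, List.range_add, Function.comp_def, add_assoc]

@[simp] theorem factor_one {N : ℕ} (w : ℤ → Fin N) (i : ℤ) : factor w i 1 = [w i] := by
  simp [factor]

@[simp] theorem factor_zero {N : ℕ} (w : ℤ → Fin N) (i : ℤ) : factor w i 0 = [] := rfl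

/-- The vertices of the geodesic of `F_N` through `1` whose labels are the letters of `w`. -/
def vertex {N : ℕ} (w : ℤ → Fin N) : ℤ → F N
  | Int.ofNat n => posWord (factor w 0 n)
  | Int.negSucc n => (posWord (factor w (-(n + 1 : ℕ)) (n + 1)))⁻¹

theorem vertex_natCast {N : ℕ} (w : ℤ → Fin N) (n : ℕ) :
    vertex w n = posWord (factor w 0 n) := rfl

theorem vertex_neg_natCast {N : ℕ} (w : ℤ → Fin N) (n : ℕ) :
    vertex w (-n) = (posWord (factor w (-n) n))⁻¹ := by
  cases n with
  | zero =>
    rw [Nat.cast_zero, neg_zero, factor_zero, posWord_nil, inv_one]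
    exact vertex_natCast w 0
  | succ n => rfl

@[simp] theorem vertex_zero {N : ℕ} (w : ℤ → Fin N) : vertex w 0 = 1 := vertex_natCast w 0

theorem vertex_add_one {N : ℕ} (w : ℤ → Fin N) (n : ℤ) :
    vertex w (n + 1) = vertex w n * FreeGroup.of (w n) := by
  obtain ⟨n, rfl | rfl⟩ := n.eq_nat_or_neg
  · rw [← Nat.cast_succ, vertex_natCast, vertex_natCast, Nat.succ_eq_add_one, factor_add,
      posWord_append]
    simp [posWord_singleton]
  · cases n with
    | zero =>
      simpa [posWord_singleton] using vertex_natCast w 1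
    | succ n =>
      rw [show -((n + 1 : ℕ) : ℤ) + 1 = -(n : ℤ) by push_cast; ring, vertex_neg_natCast,
        vertex_neg_natCast, Nat.add_comm n 1, factor_add, posWord_append, factor_one,
        posWord_singleton, show -((1 + n : ℕ) : ℤ) + (1 : ℕ) = -(n : ℤ) by push_cast; ring]
      group

theorem vertex_add_natCast {N : ℕ} (w : ℤ → Fin N) (n : ℤ) (k : ℕ) :
    vertex w (n + k) = vertex w n * posWord (factor w n k) := by
  induction k with
  | zero => simp [posWord_nil]
  | succ k ih =>
    rw [Nat.cast_succ, ← add_assoc, vertex_add_one, ih, factor_add, posWord_append, factor_one,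
      posWord_singleton, mul_assoc]

@[simp] theorem expSum_vertex {N : ℕ} (w : ℤ → Fin N) (n : ℤ) : expSum (vertex w n) = n := by
  obtain ⟨n, rfl | rfl⟩ := n.eq_nat_or_neg
  · simp [vertex_natCast]
  · simp [vertex_neg_natCast]

/-- The pair of end points of a bi-infinite word. -/
def ends {N : ℕ} (w : ℤ → Fin N) : Boundary N × Boundary N :=
  (⟨fun i => (w (-1 - i), false), fun i h => by simpa using congrArg Prod.snd h⟩,
    ⟨fun i => (w i, true), fun i h => by simpa using congrArg Prod.snd h⟩)

theorem letter_ends_fst {N : ℕ} (w : ℤ → Fin N) (i : ℕ) :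
    (ends w).1.letter i = (w (-1 - i), false) := rfl

theorem letter_ends_snd {N : ℕ} (w : ℤ → Fin N) (i : ℕ) :
    (ends w).2.letter i = (w i, true) := rfl

theorem ends_injective {N : ℕ} : Function.Injective (ends : (ℤ → Fin N) → _) := by
  intro w w' h
  funext i
  rcases i with i | i
  · have := congrArg (fun Z => (Z.2.letter i).1) h
    exact this
  · have := congrArg (fun Z => (Z.1.letter i).1) h
    simp only [letter_ends_fst] at this
    rwa [show Int.negSucc i = -1 - i by omega]

theorem letters_ends_snd {N : ℕ} (w : ℤ → Fin N) (n : ℕ) :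
    (ends w).2.letters n = (factor w 0 n).map fun a => (a, true) := by
  simp [Boundary.letters, ends, factor]

theorem pref_ends_snd {N : ℕ} (w : ℤ → Fin N) (n : ℕ) : (ends w).2.pref n = vertex w n := by
  rw [Boundary.pref, letters_ends_snd, vertex_natCast, posWord]

theorem pref_ends_fst {N : ℕ} (w : ℤ → Fin N) (n : ℕ) : (ends w).1.pref n = vertex w (-n) := by
  induction n with
  | zero => simp [Boundary.pref, Boundary.letters, ← FreeGroup.one_eq_mk]
  | succ n ih =>
    have h1 := vertex_add_one w (-(n + 1 : ℕ))
    rw [show -((n + 1 : ℕ) : ℤ) + 1 = -(n : ℤ) by push_cast; ring] at h1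
    rw [Boundary.pref_succ, ih, h1, mul_assoc, letter_ends_fst,
      show (-1 - n : ℤ) = -(n + 1 : ℕ) by push_cast; ring, FreeGroup.of, FreeGroup.mul_mk]
    have h2 : (FreeGroup.mk ([(w (-(n + 1 : ℕ)), true)] ++ [(w (-(n + 1 : ℕ)), false)]) : F N) =
        FreeGroup.of (w (-(n + 1 : ℕ))) * (FreeGroup.of (w (-(n + 1 : ℕ))))⁻¹ := by
      rw [FreeGroup.of, FreeGroup.inv_mk, FreeGroup.mul_mk]; rfl
    rw [h2]
    simp

/-- A pair of a negative and a positive boundary point is the pair of end points of a bi-infinite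
word. -/
theorem exists_eq_ends {N : ℕ} {Z : Boundary N × Boundary N}
    (h1 : ∀ i, (Z.1.letter i).2 = false) (h2 : ∀ i, (Z.2.letter i).2 = true) :
    ∃ w, Z = ends w := by
  refine ⟨fun | Int.ofNat i => (Z.2.letter i).1 | Int.negSucc i => (Z.1.letter i).1, ?_⟩
  refine Prod.ext (Subtype.ext (funext fun i => Prod.ext ?_ (h1 i)))
    (Subtype.ext (funext fun i => Prod.ext rfl (h2 i)))
  change _ = ((ends _).1.letter i).1
  rw [letter_ends_fst, show (-1 - i : ℤ) = Int.negSucc i by omega]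
  rfl

/-- The vertices of the geodesic of a bi-infinite word converge to its end points. -/
theorem isLimit_vertex_snd {N : ℕ} (w : ℤ → Fin N) {f : ℕ → ℤ} (hf : Tendsto f atTop atTop) :
    IsLimit (fun n => vertex w (f n)) (ends w).2 := by
  have h1 : Tendsto (fun n => (f n).toNat) atTop atTop := by
    refine tendsto_atTop.2 fun b => ?_
    filter_upwards [hf.eventually_ge_atTop b] with n hn
    omega
  refine ((isLimit_pref (ends w).2).comp h1).congr' ?_
  filter_upwards [hf.eventually_ge_atTop 0] with n hn
  rw [Function.comp_apply, pref_ends_snd, Int.toNat_of_nonneg hn]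

theorem isLimit_vertex_fst {N : ℕ} (w : ℤ → Fin N) {f : ℕ → ℤ} (hf : Tendsto f atTop atBot) :
    IsLimit (fun n => vertex w (f n)) (ends w).1 := by
  have h1 : Tendsto (fun n => (-f n).toNat) atTop atTop := by
    refine tendsto_atTop.2 fun b => ?_
    filter_upwards [hf.eventually_le_atBot (-b)] with n hn
    omega
  refine ((isLimit_pref (ends w).1).comp h1).congr' ?_
  filter_upwards [hf.eventually_le_atBot 0] with n hn
  rw [Function.comp_apply, pref_ends_fst, Int.toNat_of_nonneg (by omega), neg_neg]

theorem tendsto_natCast_add (e : ℤ) : Tendsto (fun n : ℕ => (n : ℤ) + e) atTop atTop :=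
  tendsto_atTop_add_const_right _ _ tendsto_natCast_atTop_atTop

theorem tendsto_neg_natCast_add (e : ℤ) : Tendsto (fun n : ℕ => -(n : ℤ) + e) atTop atBot :=
  tendsto_atBot_add_const_right _ _ (tendsto_neg_atTop_atBot.comp tendsto_natCast_atTop_atTop)

/-- A translation sends the end points of a bi-infinite word to those of another one only if it
sends the geodesic of the first to the geodesic of the second. -/
theorem translate₂_ends_eq_iff {N : ℕ} {g : F N} {w w' : ℤ → Fin N} :
    translate₂ g (ends w) = ends w' ↔ ∀ n, g * vertex w n = vertex w' (n + expSum g) := by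
  constructor
  · intro h
    -- Far out on both rays the vertices correspond under `g`. A vertex has its position as exponent
    -- sum, so the offset is `expSum g` on either side.
    obtain ⟨c, c', h2⟩ := exists_pref_translate g (ends w).2
    obtain ⟨d, d', h1⟩ := exists_pref_translate g (ends w).1
    rw [show translate g (ends w).2 = (ends w').2 from congrArg Prod.snd h] at h2
    rw [show translate g (ends w).1 = (ends w').1 from congrArg Prod.fst h] at h1
    simp only [pref_ends_fst, pref_ends_snd] at h1 h2
    have e1 := congrArg expSum (h1 0)
    have e2 := congrArg expSum (h2 0)
    simp only [expSum_mul, expSum_vertex] at e1 e2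
    have h3 : ∀ n : ℤ, c' ≤ n → g * vertex w n = vertex w' (n + expSum g) := by
      intro n hn
      have := h2 (n - c').toNat
      push_cast [Int.toNat_of_nonneg (show 0 ≤ n - c' by omega)] at this
      rw [sub_add_cancel] at this
      rw [← this]
      congr 1
      push_cast at e2
      omega
    have h4 : ∀ n : ℤ, n ≤ -d' → g * vertex w n = vertex w' (n + expSum g) := by
      intro n hn
      have := h1 (-d' - n).toNat
      push_cast [Int.toNat_of_nonneg (show 0 ≤ -d' - n by omega)] at this
      rw [show (-(-d' - n + d') : ℤ) = n by ring] at this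
      rw [← this]
      congr 1
      push_cast at e1
      omega
    -- Between the two matched vertices, both words spell the same group element; positive words are
    -- determined by the element they spell.
    have h5 : factor w (-d') (d' + c') = factor w' (-d' + expSum g) (d' + c') := by
      apply posWord_injective
      have h6 := vertex_add_natCast w (-d') (d' + c')
      have h7 := vertex_add_natCast w' (-d' + expSum g) (d' + c')
      rw [← h4 _ le_rfl, add_right_comm, ← h3 _ (by push_cast; omega), h6, ← mul_assoc] at h7
      exact mul_left_cancel h7
    intro n
    by_cases hn : c' ≤ n
    · exact h3 n hn
    by_cases hn' : n ≤ -d'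
    · exact h4 n hn'
    obtain ⟨k, rfl⟩ : ∃ k : ℕ, n = -d' + k := ⟨(n + d').toNat, by omega⟩
    obtain ⟨r, hr⟩ : ∃ r, d' + c' = k + r := ⟨d' + c' - k, by omega⟩
    rw [hr, factor_add, factor_add] at h5
    have h6 := (List.append_inj h5 (by simp)).1
    rw [vertex_add_natCast, ← mul_assoc, h4 _ le_rfl, h6, add_right_comm, vertex_add_natCast]
  · intro h
    refine Prod.ext ?_ ?_
    · refine (isLimit_pref _).translate_eq ?_
      simp only [pref_ends_fst, h]
      exact isLimit_vertex_fst w' (tendsto_neg_natCast_add _)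
    · refine (isLimit_pref _).translate_eq ?_
      simp only [pref_ends_snd, h]
      exact isLimit_vertex_snd w' (tendsto_natCast_add _)

/-! ### The action of positive automorphisms on bi-infinite words -/

theorem IsPositive.natCast_le_expSum {N : ℕ} {ψ : MulAut (F N)} (h : IsPositive ψ)
    (l : List (Fin N)) : (l.length : ℤ) ≤ expSum (ψ (posWord l)) := by
  rw [h.apply_posWord, expSum_posWord]
  exact_mod_cast h.length_le_flatMap l

theorem IsPositive.expSum_vertex_add {N : ℕ} {ψ : MulAut (F N)} (h : IsPositive ψ)
    (w : ℤ → Fin N) (n : ℤ) (k : ℕ) :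
    expSum (ψ (vertex w n)) + k ≤ expSum (ψ (vertex w (n + k))) := by
  have := h.natCast_le_expSum (factor w n k)
  rw [vertex_add_natCast, map_mul, expSum_mul]
  simpa using this

theorem IsPositive.tendsto_expSum_atTop {N : ℕ} {ψ : MulAut (F N)} (h : IsPositive ψ)
    (w : ℤ → Fin N) : Tendsto (fun n : ℕ => expSum (ψ (vertex w n))) atTop atTop := by
  refine tendsto_atTop_mono (fun n => ?_) tendsto_natCast_atTop_atTop
  simpa using h.expSum_vertex_add w 0 n

theorem IsPositive.tendsto_expSum_atBot {N : ℕ} {ψ : MulAut (F N)} (h : IsPositive ψ)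
    (w : ℤ → Fin N) : Tendsto (fun n : ℕ => expSum (ψ (vertex w (-n)))) atTop atBot := by
  refine tendsto_atBot_mono (fun n => ?_)
    (tendsto_neg_atTop_atBot.comp (tendsto_natCast_atTop_atTop (R := ℤ)))
  have := h.expSum_vertex_add w (-n) n
  rw [neg_add_cancel, vertex_zero, map_one, expSum_one] at this
  dsimp only [Function.comp_apply]
  omega

theorem snd_eq_of_prefix_toWord {N : ℕ} {X : Boundary N} {u : F N} {i : ℕ} {b : Bool}
    (h : X.letters (i + 1) <+: u.toWord) (hu : ∀ x ∈ u.toWord, x.2 = b) : (X.letter i).2 = b :=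
  hu _ (h.subset (List.mem_map.2 ⟨i, by simp, rfl⟩))

theorem snd_eq_false_of_mem_inv {N : ℕ} {l : List (Fin N)} {x : Letter N}
    (h : x ∈ ((posWord l)⁻¹).toWord) : x.2 = false := by
  rw [FreeGroup.toWord_inv, toWord_posWord] at h
  simp only [FreeGroup.invRev, List.map_map, List.mem_reverse, List.mem_map] at h
  obtain ⟨a, -, rfl⟩ := h
  rfl

/-- A pair of limits of increasing negative and positive words is the pair of end points of a
bi-infinite word. -/
theorem exists_eq_ends_of_isLimit {N : ℕ} {Z : Boundary N × Boundary N}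
    {l r : ℕ → List (Fin N)} (hl : ∀ m n, m ≤ n → l m <:+ l n) (hr : ∀ m n, m ≤ n → r m <+: r n)
    (hX : IsLimit (fun n => (posWord (l n))⁻¹) Z.1) (hY : IsLimit (fun n => posWord (r n)) Z.2) :
    ∃ w, Z = ends w ∧ ∀ n, (posWord (l n))⁻¹ = vertex w (-(l n).length) ∧
      posWord (r n) = vertex w (r n).length := by
  obtain ⟨w, rfl⟩ : ∃ w, Z = ends w := by
    apply exists_eq_ends
    · intro i
      obtain ⟨n, hn⟩ := (hX (i + 1)).exists
      exact snd_eq_of_prefix_toWord hn fun x hx => snd_eq_false_of_mem_inv hx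
    · intro i
      obtain ⟨n, hn⟩ := (hY (i + 1)).exists
      refine snd_eq_of_prefix_toWord hn fun x hx => ?_
      simp only [toWord_posWord] at hx
      obtain ⟨a, -, rfl⟩ := List.mem_map.1 hx
      rfl
  refine ⟨w, rfl, fun n => ⟨?_, ?_⟩⟩
  · have h1 := hX.eq_pref (fun m n hmn => by
      obtain ⟨t, ht⟩ := hl m n hmn
      simp only [← ht, FreeGroup.toWord_inv, toWord_posWord, List.map_append,
        FreeGroup.invRev_append]
      exact List.prefix_append _ _) n
    rwa [pref_ends_fst, FreeGroup.norm_inv_eq, norm_posWord] at h1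
  · have h1 := hY.eq_pref (fun m n hmn => by
      obtain ⟨t, ht⟩ := hr m n hmn
      simp only [← ht, toWord_posWord, List.map_append]
      exact List.prefix_append _ _) n
    rwa [pref_ends_snd, norm_posWord] at h1

/-- No cancellation occurs in images of positive words, so the images of the vertices of `u` lie on
the image geodesic, at the position given by their exponent sum. -/
theorem IsPositive.exists_boundaryMap₂_ends {N : ℕ} {ψ : MulAut (F N)} (h : IsPositive ψ)
    (u : ℤ → Fin N) : ∃ w, boundaryMap₂ ψ (ends u) = ends w ∧
      ∀ n, ψ (vertex u n) = vertex w (expSum (ψ (vertex u n))) := by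
  have hX := boundaryMap_spec ψ (ends u).1
  have hY := boundaryMap_spec ψ (ends u).2
  have hv : ∀ n : ℕ, ψ (vertex u n) = posWord ((factor u 0 n).flatMap (image ψ)) := fun n => by
    rw [vertex_natCast, h.apply_posWord]
  have hv' : ∀ n : ℕ, ψ (vertex u (-n)) =
      (posWord ((factor u (-n) n).flatMap (image ψ)))⁻¹ := fun n => by
    rw [vertex_neg_natCast, map_inv, h.apply_posWord]
  simp only [pref_ends_fst, pref_ends_snd, hv, hv'] at hX hY
  obtain ⟨w, hw, hw'⟩ := exists_eq_ends_of_isLimit (Z := boundaryMap₂ ψ (ends u))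
    (fun m n hmn => by
      obtain ⟨k, rfl⟩ := Nat.exists_eq_add_of_le' hmn
      simp only [factor_add, List.flatMap_append]
      rw [show -((k + m : ℕ) : ℤ) + k = -m by push_cast; ring]
      exact List.suffix_append _ _)
    (fun m n hmn => by
      obtain ⟨k, rfl⟩ := Nat.exists_eq_add_of_le hmn
      simp only [factor_add, List.flatMap_append]
      exact List.prefix_append _ _) hX hY
  refine ⟨w, hw, fun n => ?_⟩
  obtain ⟨n, rfl | rfl⟩ := n.eq_nat_or_neg
  · rw [hv, expSum_posWord, (hw' n).2]
  · rw [hv', expSum_inv, expSum_posWord, (hw' n).1]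

/-- Turns a desubstitution relation between boundary points into identities in `F_N`, to which
exponent sums apply. -/
theorem IsPositive.translate₂_boundaryMap₂_eq_iff {N : ℕ} {ψ : MulAut (F N)} (h : IsPositive ψ)
    {u w : ℤ → Fin N} {q : F N} :
    translate₂ q⁻¹ (boundaryMap₂ ψ (ends u)) = ends w ↔
      ∀ n, q⁻¹ * ψ (vertex u n) = vertex w (expSum (ψ (vertex u n)) - expSum q) := by
  constructor
  · obtain ⟨v, hv, hv'⟩ := h.exists_boundaryMap₂_ends u
    rw [hv, translate₂_ends_eq_iff]
    intro h1 n
    conv_lhs => rw [hv', h1]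
    rw [expSum_inv, sub_eq_add_neg]
  · intro h1
    refine Prod.ext ?_ ?_
    · refine (boundaryMap_spec ψ _).translate_eq ?_
      simp only [pref_ends_fst, h1]
      exact isLimit_vertex_fst w
        (tendsto_atBot_add_const_right _ (-expSum q) (h.tendsto_expSum_atBot u))
    · refine (boundaryMap_spec ψ _).translate_eq ?_
      simp only [pref_ends_snd, h1]
      exact isLimit_vertex_snd w
        (tendsto_atTop_add_const_right _ (-expSum q) (h.tendsto_expSum_atTop u))

theorem IsPositive.boundaryMap₂_mul {N : ℕ} {φ ψ : MulAut (F N)} (hφ : IsPositive φ)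
    (hψ : IsPositive ψ) (u : ℤ → Fin N) :
    boundaryMap₂ (φ * ψ) (ends u) = boundaryMap₂ φ (boundaryMap₂ ψ (ends u)) := by
  obtain ⟨v, hv, hv'⟩ := hψ.exists_boundaryMap₂_ends u
  obtain ⟨w, hw, hw'⟩ := hφ.exists_boundaryMap₂_ends v
  rw [hv, hw]
  have h1 := ((hφ.mul hψ).translate₂_boundaryMap₂_eq_iff (u := u) (w := w) (q := 1)).2
  rw [inv_one, translate₂_one] at h1
  refine h1 fun n => ?_
  rw [one_mul, expSum_one, sub_zero, MulAut.mul_apply, hv', ← hw']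

theorem boundaryMap₂_one {N : ℕ} (Z : Boundary N × Boundary N) :
    boundaryMap₂ (1 : MulAut (F N)) Z = Z :=
  Prod.ext ((boundaryMap_spec _ _).unique (isLimit_pref _))
    ((boundaryMap_spec _ _).unique (isLimit_pref _))

/-- The inverse of `ψ` need not be positive. But its boundary map can be computed along the
subsequence of prefixes of the form `ψ(vertex u n)`, which it sends back to the vertices of `u`. -/
theorem IsPositive.boundaryMap₂_inv_boundaryMap₂ {N : ℕ} {ψ : MulAut (F N)} (h : IsPositive ψ)
    (u : ℤ → Fin N) : boundaryMap₂ ψ⁻¹ (boundaryMap₂ ψ (ends u)) = ends u := by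
  obtain ⟨v, hv, hv'⟩ := h.exists_boundaryMap₂_ends u
  rw [hv]
  refine Prod.ext ?_ ?_
  · have h2 : Tendsto (fun n : ℕ => (-expSum (ψ (vertex u (-n)))).toNat) atTop atTop := by
      refine tendsto_atTop.2 fun b => ?_
      filter_upwards [(h.tendsto_expSum_atBot u).eventually_le_atBot (-b)] with n hn
      omega
    refine ((boundaryMap_spec ψ⁻¹ (ends v).1).comp h2).unique
      ((isLimit_pref (ends u).1).congr' ?_)
    filter_upwards [(h.tendsto_expSum_atBot u).eventually_le_atBot 0] with n hn
    rw [Function.comp_apply, pref_ends_fst, pref_ends_fst, Int.toNat_of_nonneg (by omega),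
      neg_neg, ← hv', MulAut.inv_apply_self]
  · have h2 : Tendsto (fun n : ℕ => (expSum (ψ (vertex u n))).toNat) atTop atTop := by
      refine tendsto_atTop.2 fun b => ?_
      filter_upwards [(h.tendsto_expSum_atTop u).eventually_ge_atTop b] with n hn
      omega
    refine ((boundaryMap_spec ψ⁻¹ (ends v).2).comp h2).unique
      ((isLimit_pref (ends u).2).congr' ?_)
    filter_upwards [(h.tendsto_expSum_atTop u).eventually_ge_atTop 0] with n hn
    rw [Function.comp_apply, pref_ends_snd, pref_ends_snd, Int.toNat_of_nonneg hn, ← hv',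
      MulAut.inv_apply_self]

/-- Words whose images lie in one orbit lie in one orbit themselves. This is where invertibility
replaces recognizability. -/
theorem IsPositive.ends_eq_translate₂ {N : ℕ} {ψ : MulAut (F N)} (hψ : IsPositive ψ)
    {u u' : ℤ → Fin N} {h : F N}
    (hu : boundaryMap₂ ψ (ends u') = translate₂ h (boundaryMap₂ ψ (ends u))) :
    ends u' = translate₂ (ψ⁻¹ h) (ends u) := by
  rw [← hψ.boundaryMap₂_inv_boundaryMap₂ u', hu, boundaryMap₂_translate₂,
    hψ.boundaryMap₂_inv_boundaryMap₂]

/-! ### Cuts and uniqueness of desubstitution -/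

theorem IsCut.image_eq {N : ℕ} {ψ : MulAut (F N)} (hψ : IsPositive ψ) {a b : Fin N} {p s : F N}
    (h : IsCut (ψ (FreeGroup.of b)) p a s) :
    ∃ l r, p = posWord l ∧ s = posWord r ∧ image ψ b = l ++ a :: r := by
  have h1 := (hψ b).2
  rw [show (ψ (FreeGroup.of b)).toWord = _ from h] at h1
  refine ⟨p.toWord.map Prod.fst, s.toWord.map Prod.fst, eq_posWord fun x hx => h1 x (by simp [hx]),
    eq_posWord fun x hx => h1 x (by simp [hx]), ?_⟩
  rw [image, show (ψ (FreeGroup.of b)).toWord = _ from h]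
  simp

theorem IsCut.eq_mul {N : ℕ} {v p s : F N} {a : Fin N} (h : IsCut v p a s) :
    v = p * FreeGroup.of a * s := by
  rw [← FreeGroup.mk_toWord (x := v), show v.toWord = _ from h]
  conv_rhs => rw [← FreeGroup.mk_toWord (x := p), ← FreeGroup.mk_toWord (x := s)]
  simp [FreeGroup.of, FreeGroup.mul_mk]

theorem IsCut.expSum_nonneg {N : ℕ} {ψ : MulAut (F N)} (hψ : IsPositive ψ) {a b : Fin N}
    {p s : F N} (h : IsCut (ψ (FreeGroup.of b)) p a s) : 0 ≤ expSum p ∧ 0 ≤ expSum s := by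
  obtain ⟨l, r, rfl, rfl, -⟩ := h.image_eq hψ
  simp

theorem IsCut.eq_one {N : ℕ} {ψ : MulAut (F N)} (hψ : IsPositive ψ) {a b : Fin N}
    {p s : F N} (h : IsCut (ψ (FreeGroup.of b)) p a s) :
    (expSum p = 0 → p = 1) ∧ (expSum s = 0 → s = 1) := by
  obtain ⟨l, r, rfl, rfl, -⟩ := h.image_eq hψ
  simp +contextual [posWord_nil]

/-- Two desubstitutions of words in the same orbit are in the same orbit, at a controlled
distance. -/
theorem IsPositive.exists_desubstitution_translate {N : ℕ} {ψ : MulAut (F N)} (hψ : IsPositive ψ)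
    {w w' u u' : ℤ → Fin N} {p p' s g : F N} {a : Fin N}
    (h : ends w = translate₂ p⁻¹ (boundaryMap₂ ψ (ends u)))
    (h' : ends w' = translate₂ p'⁻¹ (boundaryMap₂ ψ (ends u')))
    (hc : IsCut (ψ (FreeGroup.of (u 0))) p a s) (hg : ends w' = translate₂ g (ends w)) :
    ∃ g₁, ends u' = translate₂ g₁ (ends u) ∧ ψ g₁ = p' * g * p⁻¹ ∧
      (expSum g₁ < 0 → -expSum g₁ + expSum s + expSum p' ≤ -expSum g) := by
  have hg₁ := hψ.ends_eq_translate₂ (u := u) (u' := u') (h := p' * g * p⁻¹) (by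
    rw [eq_comm, translate₂_inv_eq_iff] at h'
    rw [h', hg, h, ← translate₂_mul, ← translate₂_mul])
  -- The hypotheses combine to `ψ(u') = p' g p⁻¹ ψ(u)`.
  refine ⟨ψ⁻¹ (p' * g * p⁻¹), hg₁, MulAut.apply_inv_self _ _ _, ?_⟩
  have h0 := congrArg expSum (MulAut.apply_inv_self (F N) ψ (p' * g * p⁻¹))
  generalize ψ⁻¹ (p' * g * p⁻¹) = g₁ at hg₁ h0
  intro hneg
  -- With `m = -expSum g₁ > 0`, `g₁` sends the vertex of `u` at `m` to 1. Hence `-expSum (ψ g₁)` is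
  -- the length of `ψ(u_0 ⋯ u_{m-1})`, which is at least `|p| + 1 + |s| + (m - 1)`.
  have h1 := translate₂_ends_eq_iff.1 hg₁.symm (-expSum g₁)
  rw [neg_add_cancel, vertex_zero] at h1
  have h2 := congrArg (fun x => expSum (ψ x)) h1
  simp only [map_mul, expSum_mul, map_one, expSum_one] at h2
  have h3 := hψ.expSum_vertex_add u 1 (-expSum g₁ - 1).toNat
  rw [Int.toNat_of_nonneg (by omega), add_sub_cancel] at h3
  have h4 : vertex u 1 = FreeGroup.of (u 0) := by simpa using vertex_add_one u 0
  rw [h4, hc.eq_mul] at h3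
  simp only [expSum_mul, expSum_of, expSum_inv] at h3 h0
  linarith

/-- Desubstitution is unique. -/
theorem IsPositive.desubstitution_unique {N : ℕ} {ψ : MulAut (F N)} (hψ : IsPositive ψ)
    {w u u' : ℤ → Fin N} {p p' s s' : F N} {a a' : Fin N}
    (h : ends w = translate₂ p⁻¹ (boundaryMap₂ ψ (ends u)))
    (h' : ends w = translate₂ p'⁻¹ (boundaryMap₂ ψ (ends u')))
    (hc : IsCut (ψ (FreeGroup.of (u 0))) p a s) (hc' : IsCut (ψ (FreeGroup.of (u' 0))) p' a' s') :
    u = u' ∧ p = p' := by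
  obtain ⟨g, hg, hg', h1⟩ :=
    hψ.exists_desubstitution_translate h h' hc (translate₂_one _).symm
  obtain ⟨k, hk, hk', h2⟩ :=
    hψ.exists_desubstitution_translate h' h hc' (translate₂_one _).symm
  have h3 : k = g⁻¹ := by
    apply ψ.injective
    rw [map_inv, hg', hk']
    group
  have h4 := hc.expSum_nonneg hψ
  have h5 := hc'.expSum_nonneg hψ
  rw [expSum_one, neg_zero] at h1 h2
  rw [h3, expSum_inv] at h2
  -- A nonzero displacement would make a positive quantity at most 0, in one of the two directions.
  have h6 : expSum g = 0 := by
    by_contra h6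
    rcases lt_or_gt_of_ne h6 with h6 | h6
    · have := h1 h6
      omega
    · have := h2 (by omega)
      omega
  -- With exponent sum 0, `g` sends the vertex 1 at the origin to the vertex 1 at the origin, so `g
  -- = 1`.
  have h7 := translate₂_ends_eq_iff.1 hg.symm 0
  rw [h6, zero_add, vertex_zero, vertex_zero, mul_one] at h7
  subst h7
  rw [translate₂_one] at hg
  refine ⟨(ends_injective hg).symm, ?_⟩
  rw [map_one, mul_one] at hg'
  exact (mul_inv_eq_one.1 hg'.symm).symm

/-! ### Closures and shifts -/

/-- Stated for an arbitrary discrete alphabet, so that the topology `⊥` used for `Boundary` can be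
supplied explicitly. -/
theorem isOpen_induced_setOf_apply_eq {α β ι : Type*} [TopologicalSpace α] [DiscreteTopology α]
    (f : β → ι → α) (i : ι) (x : α) :
    @IsOpen β (TopologicalSpace.induced f inferInstance) {b | f b i = x} :=
  isOpen_induced_iff.2 ⟨_, (isOpen_discrete {x}).preimage (continuous_apply i), rfl⟩

theorem tendsto_induced_of_eventually_apply_eq {α β ι γ : Type*} [TopologicalSpace α]
    [DiscreteTopology α] (f : β → ι → α) {l : Filter γ} {u : γ → β} {b : β}
    (h : ∀ i, ∀ᶠ n in l, f (u n) i = f b i) :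
    Tendsto u l (@nhds β (TopologicalSpace.induced f inferInstance) b) := by
  rw [nhds_induced, tendsto_comap_iff, tendsto_pi_nhds]
  intro i
  rw [nhds_discrete, tendsto_pure]
  exact h i

theorem isOpen_setOf_letter_eq {N : ℕ} (i : ℕ) (x : Letter N) :
    IsOpen {X : Boundary N | X.letter i = x} :=
  @isOpen_induced_setOf_apply_eq _ _ _ ⊥ (@DiscreteTopology.mk _ ⊥ rfl) Boundary.letter i x

theorem tendsto_boundary {N : ℕ} {u : ℕ → Boundary N} {X : Boundary N}
    (h : ∀ i, ∀ᶠ n in atTop, (u n).letter i = X.letter i) : Tendsto u atTop (nhds X) :=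
  @tendsto_induced_of_eventually_apply_eq _ _ _ _ ⊥ (@DiscreteTopology.mk _ ⊥ rfl)
    Boundary.letter _ _ _ h

theorem mem_closure_iff_letter {N : ℕ} {S : Set (Boundary N × Boundary N)}
    {W : Boundary N × Boundary N} :
    W ∈ closure S ↔ ∀ m, ∃ Z ∈ S, ∀ i < m,
      Z.1.letter i = W.1.letter i ∧ Z.2.letter i = W.2.letter i := by
  constructor
  · intro h m
    have h1 : IsOpen (⋂ i ∈ Finset.range m, {Z : Boundary N × Boundary N |
        Z.1.letter i = W.1.letter i ∧ Z.2.letter i = W.2.letter i}) :=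
      isOpen_biInter_finset fun i _ =>
        ((isOpen_setOf_letter_eq i _).preimage continuous_fst).inter
          ((isOpen_setOf_letter_eq i _).preimage continuous_snd)
    obtain ⟨Z, hZ, hZ'⟩ := mem_closure_iff.1 h _ h1 (by simp)
    exact ⟨Z, hZ', by simpa using hZ⟩
  · intro h
    choose Z hZ hZ' using h
    refine mem_closure_of_tendsto (f := Z) (b := atTop) ?_ (Eventually.of_forall hZ)
    refine Tendsto.prodMk_nhds (tendsto_boundary fun i => ?_) (tendsto_boundary fun i => ?_)
    · filter_upwards [eventually_gt_atTop i] with n hn using (hZ' n i hn).1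
    · filter_upwards [eventually_gt_atTop i] with n hn using (hZ' n i hn).2

theorem vertex_shift {N : ℕ} (w : ℤ → Fin N) (z n : ℤ) :
    vertex (fun i => w (i + z)) n = (vertex w z)⁻¹ * vertex w (n + z) := by
  induction n using Int.induction_on with
  | zero => simp
  | succ n ih => rw [vertex_add_one, ih, mul_assoc, add_right_comm, vertex_add_one]
  | pred n ih =>
    have h1 := vertex_add_one (fun i => w (i + z)) (-n - 1)
    have h2 := vertex_add_one w (-n - 1 + z)
    rw [add_right_comm, sub_add_cancel] at h2
    rw [sub_add_cancel, ih, h2, ← mul_assoc, mul_left_inj] at h1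
    exact h1.symm

theorem translate₂_vertex_inv {N : ℕ} (w : ℤ → Fin N) (z : ℤ) :
    translate₂ (vertex w z)⁻¹ (ends w) = ends fun i => w (i + z) := by
  rw [translate₂_ends_eq_iff]
  intro n
  rw [vertex_shift, expSum_inv, expSum_vertex, neg_add_cancel_right]

theorem shift_ends {N : ℕ} (w : ℤ → Fin N) : shift (ends w) = ends fun i => w (i + 1) := by
  rw [← translate₂_vertex_inv, shift, letter_ends_snd, ← zero_add 1, vertex_add_one, vertex_zero,
    one_mul]
  rfl

theorem shiftInv_ends {N : ℕ} (w : ℤ → Fin N) :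
    shiftInv (ends w) = ends fun i => w (i + (-1)) := by
  rw [← translate₂_vertex_inv, shiftInv, letter_ends_fst]
  have h1 : vertex w (-1) = (FreeGroup.of (w (-1)))⁻¹ := by
    have h2 := vertex_add_one w (-1)
    rw [neg_add_cancel, vertex_zero] at h2
    exact eq_inv_of_mul_eq_one_left h2.symm
  rw [h1]
  rfl

theorem shiftZ_ends {N : ℕ} (w : ℤ → Fin N) (z : ℤ) :
    shiftZ z (ends w) = ends fun i => w (i + z) := by
  rcases z with z | z
  · change shift^[z] (ends w) = _
    induction z with
    | zero => simp
    | succ z ih =>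
      rw [Function.iterate_succ_apply', ih, shift_ends]
      congr 1
      funext i
      congr 1
      simp only [Int.ofNat_eq_natCast]
      push_cast
      ring
  · change shiftInv^[z + 1] (ends w) = _
    have h : ∀ n : ℕ, shiftInv^[n] (ends w) = ends fun i => w (i - n) := by
      intro n
      induction n with
      | zero => simp
      | succ n ih =>
        rw [Function.iterate_succ_apply', ih, shiftInv_ends]
        congr 1
        funext i
        congr 1
        push_cast
        ring
    rw [h]
    rfl

/-! ### The language of a positive automorphism -/

/-- The set of factors of the words `φ^k(a)`. -/
def language {N : ℕ} (φ : MulAut (F N)) : Set (List (Fin N)) :=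
  {v | ∃ k a, v <:+: image (φ ^ k) a}

/-- The bi-infinite words all of whose factors belong to the language. -/
def languageShift {N : ℕ} (φ : MulAut (F N)) : Set (ℤ → Fin N) :=
  {w | ∀ i n, factor w i n ∈ language φ}

theorem infix_flatMap_of_mem {α β : Type*} {a : α} {l : List α} (f : α → List β) (h : a ∈ l) :
    f a <:+: l.flatMap f := by
  obtain ⟨s, t, rfl⟩ := List.append_of_mem h
  exact ⟨s.flatMap f, t.flatMap f, by simp⟩

theorem mem_image_iff {N : ℕ} {ψ : MulAut (F N)} (h : IsPositive ψ) {a b : Fin N} :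
    (b, true) ∈ (ψ (FreeGroup.of a)).toWord ↔ b ∈ image ψ a := by
  rw [h.apply_of, toWord_posWord]
  simp

theorem IsPositive.image_pow_add {N : ℕ} {φ : MulAut (F N)} (h : IsPositive φ) (m n : ℕ)
    (a : Fin N) : image (φ ^ (m + n)) a = (image (φ ^ n) a).flatMap (image (φ ^ m)) := by
  rw [pow_add, (h.pow m).image_mul (h.pow n)]

theorem IsPrimitive.exists_mem_image {N : ℕ} {φ : MulAut (F N)} (hprim : IsPrimitive φ)
    (hpos : IsPositive φ) : ∃ k, 1 ≤ k ∧ ∀ n, k ≤ n → ∀ a b, b ∈ image (φ ^ n) a := by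
  obtain ⟨k, hk, h⟩ := hprim
  refine ⟨k, hk, fun n hn a b => ?_⟩
  obtain ⟨m, rfl⟩ := Nat.exists_eq_add_of_le hn
  rw [hpos.image_pow_add]
  obtain ⟨c, hc⟩ := List.exists_mem_of_length_pos ((hpos.pow m).image_length_pos a)
  exact (infix_flatMap_of_mem _ hc).subset ((mem_image_iff (hpos.pow k)).1 (h c b))

/-- By primitivity, `a` occurs in all late images of every letter `b`, and then so does `φ^k(a)`. -/
theorem language_exists_infix {N : ℕ} {φ : MulAut (F N)} (hprim : IsPrimitive φ)
    (hpos : IsPositive φ) {v : List (Fin N)} (hv : v ∈ language φ) :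
    ∃ k, ∀ n, k ≤ n → ∀ b, v <:+: image (φ ^ n) b := by
  obtain ⟨K, hK, h⟩ := hprim.exists_mem_image hpos
  obtain ⟨k, a, hv⟩ := hv
  refine ⟨k + K, fun n hn b => ?_⟩
  obtain ⟨m, rfl⟩ := Nat.exists_eq_add_of_le hn
  rw [add_assoc, hpos.image_pow_add]
  exact hv.trans (infix_flatMap_of_mem _ (h _ (by omega) b a))

theorem language_exists_infix_flatMap {N : ℕ} {φ : MulAut (F N)} (hprim : IsPrimitive φ)
    (hpos : IsPositive φ) {v : List (Fin N)} (hv : v ∈ language φ) :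
    ∃ u ∈ language φ, v <:+: u.flatMap (image φ) := by
  obtain ⟨k, hk⟩ := language_exists_infix hprim hpos hv
  obtain ⟨-, a, -⟩ := hv
  refine ⟨image (φ ^ k) a, ⟨k, a, List.infix_rfl⟩, ?_⟩
  have := hk (1 + k) (by omega) a
  rwa [hpos.image_pow_add, pow_one] at this

theorem factor_infix {N : ℕ} (w : ℤ → Fin N) {i j : ℤ} {m n : ℕ} (h1 : j ≤ i)
    (h2 : i + n ≤ j + m) : factor w i n <:+: factor w j m := by
  obtain ⟨c, rfl⟩ : ∃ c : ℕ, i = j + c := ⟨(i - j).toNat, by omega⟩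
  obtain ⟨d, rfl⟩ : ∃ d, m = c + n + d := ⟨m - (c + n), by omega⟩
  rw [factor_add, factor_add]
  exact ⟨factor w j c, _, rfl⟩

theorem exists_eq_factor {N : ℕ} {w : ℤ → Fin N} {j : ℤ} {m : ℕ} {v : List (Fin N)}
    (h : v <:+: factor w j m) : ∃ i, v = factor w i v.length := by
  obtain ⟨s, t, h⟩ := h
  have h1 := congrArg List.length h
  simp only [List.length_append, length_factor] at h1
  rw [← h1, factor_add, factor_add] at h
  exact ⟨_, (List.append_inj (List.append_inj h (by simp)).1 (by simp)).2⟩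

theorem factor_eq_iff {N : ℕ} {w w' : ℤ → Fin N} {i i' : ℤ} {n : ℕ} :
    factor w i n = factor w' i' n ↔ ∀ j : ℕ, j < n → w (i + j) = w' (i' + j) := by
  simp [factor, List.map_inj_left]

theorem factor_congr {N : ℕ} {w w' : ℤ → Fin N} {i i' : ℤ} {n : ℕ}
    (h : ∀ j : ℕ, j < n → w (i + j) = w' (i' + j)) : factor w i n = factor w' i' n :=
  factor_eq_iff.2 h

theorem factor_shift {N : ℕ} (w : ℤ → Fin N) (z i : ℤ) (n : ℕ) :
    factor (fun i => w (i + z)) i n = factor w (i + z) n :=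
  factor_congr fun j _ => by rw [add_right_comm]

theorem eq_of_factor_eq {N : ℕ} {v w : ℤ → Fin N} {m : ℕ} {z : ℤ}
    (h : factor w (-m) (2 * m) = factor v z (2 * m)) (i : ℤ) (h1 : -m ≤ i) (h2 : i < m) :
    v (i + (z + m)) = w i := by
  have := factor_eq_iff.1 h (i + m).toNat (by omega)
  rw [Int.toNat_of_nonneg (by omega)] at this
  rw [show i + (z + m) = z + (i + m) by ring, ← this]
  congr 1
  ring

theorem shift_mem_languageShift {N : ℕ} {φ : MulAut (F N)} {w : ℤ → Fin N}
    (h : w ∈ languageShift φ) (z : ℤ) : (fun i => w (i + z)) ∈ languageShift φ := by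
  intro i n
  rw [factor_shift]
  exact h _ _

/-! ### The attracting subshift in terms of bi-infinite words -/

/-- Iterating `φ^k(a) = p a s` gives `φ^{(n+1)k}(a) = φ^{nk}(p) ⋯ p · a · s ⋯ φ^{nk}(s)`, so the
seed contains these images around its origin. -/
theorem IsSeed.exists_ends {N : ℕ} {φ : MulAut (F N)} (hpos : IsPositive φ)
    {Z : Boundary N × Boundary N} (h : IsSeed φ Z) :
    ∃ w a k, 1 ≤ k ∧ Z = ends w ∧
      ∀ n : ℕ, ∃ i j : ℕ, n ≤ i ∧ n ≤ j ∧ factor w (-i) (i + j) = image (φ ^ ((n + 1) * k)) a := by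
  obtain ⟨a, k, p, s, hp, hs, hcut, hX, hY⟩ := h
  obtain ⟨lp, ls, rfl, rfl, himg⟩ := hcut.image_eq (hpos.pow k)
  have hlp : lp ≠ [] := by rintro rfl; exact hp.1 rfl
  have hls : ls ≠ [] := by rintro rfl; exact hs.1 rfl
  -- For `k = 0` the image of `a` is the single letter `a`, which leaves no room for nonempty `p`
  -- and `s`.
  have hk : 1 ≤ k := by
    rw [Nat.one_le_iff_ne_zero]
    rintro rfl
    have h1 := congrArg List.length himg
    rw [pow_zero, image_one] at h1
    have h2 := List.length_pos_iff.2 hlp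
    simp at h1
    omega
  obtain ⟨l, hl0, hl⟩ : ∃ l : ℕ → List (Fin N), l 0 = lp ∧
      ∀ n, l (n + 1) = lp.flatMap (image (φ ^ ((n + 1) * k))) ++ l n :=
    ⟨Nat.rec lp fun n l => lp.flatMap (image (φ ^ ((n + 1) * k))) ++ l, rfl, fun _ => rfl⟩
  obtain ⟨r, hr0, hr⟩ : ∃ r : ℕ → List (Fin N), r 0 = a :: ls ∧
      ∀ n, r (n + 1) = r n ++ ls.flatMap (image (φ ^ ((n + 1) * k))) :=
    ⟨Nat.rec (a :: ls) fun n r => r ++ ls.flatMap (image (φ ^ ((n + 1) * k))), rfl, fun _ => rfl⟩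
  have hX' : ∀ n, ((List.range (n + 1)).map fun i => (φ ^ (i * k)) (posWord lp)⁻¹).prod =
      (posWord (l n))⁻¹ := by
    intro n
    induction n with
    | zero => simp [hl0]
    | succ n ih =>
      rw [List.range_succ, List.map_append, List.prod_append, ih, hl, posWord_append, mul_inv_rev]
      simp [(hpos.pow ((n + 1) * k)).apply_posWord]
  have hY' : ∀ n, FreeGroup.of a *
      ((List.range (n + 1)).map fun i => (φ ^ (i * k)) (posWord ls)).prod = posWord (r n) := by
    intro n
    induction n with
    | zero => simp [hr0, ← posWord_singleton, ← posWord_append]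
    | succ n ih =>
      rw [List.range_succ, List.map_append, List.prod_append, ← mul_assoc, ih, hr, posWord_append]
      simp [(hpos.pow ((n + 1) * k)).apply_posWord]
  simp only [hX'] at hX
  simp only [hY'] at hY
  obtain ⟨w, hw, hw'⟩ := exists_eq_ends_of_isLimit
    (fun m n hmn => by
      induction n, hmn using Nat.le_induction with
      | base => exact List.suffix_rfl
      | succ n _ ih => rw [hl]; exact ih.trans (List.suffix_append _ _))
    (fun m n hmn => by
      induction n, hmn using Nat.le_induction with
      | base => exact List.prefix_rfl
      | succ n _ ih => rw [hr]; exact ih.trans (List.prefix_append _ _)) hX hY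
  refine ⟨w, a, k, hk, hw, fun n => ⟨(l n).length, (r n).length, ?_, ?_, ?_⟩⟩
  · induction n with
    | zero => omega
    | succ n ih =>
      have h1 := (hpos.pow ((n + 1) * k)).length_le_flatMap lp
      have h2 := List.length_pos_iff.2 hlp
      rw [hl, List.length_append]
      omega
  · induction n with
    | zero => omega
    | succ n ih =>
      have h1 := (hpos.pow ((n + 1) * k)).length_le_flatMap ls
      have h2 := List.length_pos_iff.2 hls
      rw [hr, List.length_append]
      omega
  · have h1 : l n ++ r n = image (φ ^ ((n + 1) * k)) a := by
      induction n with
      | zero => rw [hl0, hr0, zero_add, one_mul, himg]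
      | succ n ih =>
        rw [show (n + 1 + 1) * k = (n + 1) * k + k by ring, hpos.image_pow_add, himg, hl, hr]
        simp [← ih]
    apply posWord_injective
    have h2 := vertex_add_natCast w (-(l n).length) ((l n).length + (r n).length)
    rw [Nat.cast_add, neg_add_cancel_left, ← (hw' n).1, ← (hw' n).2] at h2
    rw [← h1, posWord_append, h2, mul_inv_cancel_left]

theorem IsSeed.exists_languageShift {N : ℕ} {φ : MulAut (F N)} (hpos : IsPositive φ)
    (hprim : IsPrimitive φ) {Z : Boundary N × Boundary N} (h : IsSeed φ Z) :
    ∃ w ∈ languageShift φ, Z = ends w ∧ ∀ v ∈ language φ, ∃ i, v = factor w i v.length := by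
  obtain ⟨w, a, k, hk, hw, hf⟩ := h.exists_ends hpos
  refine ⟨w, fun i n => ?_, hw, fun v hv => ?_⟩
  · obtain ⟨c, d, hc, hd, hcd⟩ := hf (i.natAbs + n)
    refine ⟨(i.natAbs + n + 1) * k, a, ?_⟩
    rw [← hcd]
    apply factor_infix <;> push_cast <;> omega
  · obtain ⟨K, hK⟩ := language_exists_infix hprim hpos hv
    obtain ⟨c, d, -, -, hcd⟩ := hf K
    refine exists_eq_factor (j := -c) (m := c + d) ?_
    rw [hcd]
    exact hK _ (by nlinarith) a

theorem exists_languageShift_of_mem {N : ℕ} {φ : MulAut (F N)} (hpos : IsPositive φ)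
    (hprim : IsPrimitive φ) {W : Boundary N × Boundary N} (hW : W ∈ attractingSubshift φ) :
    ∃ w ∈ languageShift φ, W = ends w := by
  obtain ⟨-, Z, hZ, hW⟩ := hW
  obtain ⟨v, hv, rfl, -⟩ := hZ.exists_languageShift hpos hprim
  rw [mem_closure_iff_letter] at hW
  simp only [Set.exists_range_iff, shiftZ_ends] at hW
  obtain ⟨w, rfl⟩ : ∃ w, W = ends w := by
    apply exists_eq_ends
    · intro i
      obtain ⟨z, hz⟩ := hW (i + 1)
      rw [← (hz i (by omega)).1, letter_ends_fst]
    · intro i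
      obtain ⟨z, hz⟩ := hW (i + 1)
      rw [← (hz i (by omega)).2, letter_ends_snd]
  refine ⟨w, fun i n => ?_, rfl⟩
  obtain ⟨z, hz⟩ := hW (i.natAbs + n)
  have h1 : factor w i n = factor v (i + z) n := by
    rw [← factor_shift]
    refine factor_congr fun j hj => ?_
    rcases le_or_gt 0 (i + j) with h0 | h0
    · have := (hz (i + j).toNat (by omega)).2
      rw [letter_ends_snd, letter_ends_snd, Int.toNat_of_nonneg h0] at this
      exact (congrArg Prod.fst this).symm
    · have := (hz (-1 - (i + j)).toNat (by omega)).1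
      rw [letter_ends_fst, letter_ends_fst, Int.toNat_of_nonneg (by omega),
        sub_sub_cancel] at this
      exact (congrArg Prod.fst this).symm
  rw [h1]
  exact hv _ _

theorem ends_mem_attractingSubshift {N : ℕ} {φ : MulAut (F N)} (hpos : IsPositive φ)
    (hprim : IsPrimitive φ) {Z : Boundary N × Boundary N} (hZ : IsSeed φ Z) {w : ℤ → Fin N}
    (hw : w ∈ languageShift φ) : ends w ∈ attractingSubshift φ := by
  refine ⟨fun h => ?_, Z, hZ, ?_⟩
  · have := congrArg (fun X => (X.letter 0).2) h
    simp [letter_ends_fst, letter_ends_snd] at this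
  · obtain ⟨v, -, rfl, hv⟩ := hZ.exists_languageShift hpos hprim
    rw [mem_closure_iff_letter]
    simp only [Set.exists_range_iff, shiftZ_ends]
    intro m
    obtain ⟨z, hz⟩ := hv _ (hw (-m) (2 * m))
    rw [length_factor] at hz
    have h1 := eq_of_factor_eq hz
    refine ⟨z + m, fun i hi => ?_⟩
    rw [letter_ends_fst, letter_ends_fst, letter_ends_snd, letter_ends_snd,
      h1 _ (by omega) (by omega), h1 _ (by omega) (by omega)]
    exact ⟨rfl, rfl⟩

/-! ### Existence of desubstitution -/

theorem vertex_congr {N : ℕ} {w w' : ℤ → Fin N} {n : ℤ}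
    (h : ∀ j, -|n| ≤ j → j < |n| → w j = w' j) : vertex w n = vertex w' n := by
  obtain ⟨n, rfl | rfl⟩ := n.eq_nat_or_neg
  · rw [vertex_natCast, vertex_natCast]
    congr 1
    refine factor_congr fun j hj => h _ ?_ ?_ <;> rw [Nat.abs_cast] <;> omega
  · rw [vertex_neg_natCast, vertex_neg_natCast]
    congr 2
    refine factor_congr fun j hj => h _ ?_ ?_ <;> rw [abs_neg, Nat.abs_cast] <;> omega

theorem IsPositive.expSum_apply_of {N : ℕ} {ψ : MulAut (F N)} (h : IsPositive ψ) (a : Fin N) :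
    expSum (ψ (FreeGroup.of a)) = (image ψ a).length := by
  rw [h.apply_of, expSum_posWord]

/-- Every position of the image word falls in the image of some letter `u n`: take the last `n`
whose image begins at or before `z`. -/
theorem IsPositive.exists_expSum_add_eq {N : ℕ} {ψ : MulAut (F N)} (h : IsPositive ψ)
    (u : ℤ → Fin N) (z : ℤ) :
    ∃ (n : ℤ) (t : ℕ), t < (image ψ (u n)).length ∧ expSum (ψ (vertex u n)) + t = z := by
  have hbdd : ∀ n, expSum (ψ (vertex u n)) ≤ z → n ≤ max z 0 := fun n hn => by
    by_contra h1
    have h2 := h.expSum_vertex_add u 0 n.toNat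
    rw [Int.toNat_of_nonneg (by omega), zero_add, vertex_zero, map_one, expSum_one] at h2
    omega
  have hinh : expSum (ψ (vertex u (-z.natAbs))) ≤ z := by
    have h2 := h.expSum_vertex_add u (-z.natAbs) z.natAbs
    rw [neg_add_cancel, vertex_zero, map_one, expSum_one] at h2
    omega
  obtain ⟨n, hn, hn'⟩ := Int.exists_greatest_of_bdd ⟨_, hbdd⟩ ⟨_, hinh⟩
  refine ⟨n, (z - expSum (ψ (vertex u n))).toNat, ?_, by omega⟩
  have h1 := mt (hn' (n + 1)) (by omega)
  rw [vertex_add_one, map_mul, expSum_mul, h.expSum_apply_of] at h1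
  omega

/-- `w` is the image of `u` under `ψ`, with the origin at position `t` of the image of `u 0`. -/
def IsImageAt {N : ℕ} (ψ : MulAut (F N)) (u w : ℤ → Fin N) (t : ℕ) : Prop :=
  t < (image ψ (u 0)).length ∧
    ∀ n, vertex w (-t) * ψ (vertex u n) = vertex w (expSum (ψ (vertex u n)) - t)

theorem IsPositive.exists_isImageAt_shift {N : ℕ} {ψ : MulAut (F N)} (h : IsPositive ψ)
    {u v : ℤ → Fin N} (huv : ∀ n, ψ (vertex u n) = vertex v (expSum (ψ (vertex u n)))) (z : ℤ) :
    ∃ n t, IsImageAt ψ (fun i => u (i + n)) (fun i => v (i + z)) t := by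
  obtain ⟨n, t, ht, htz⟩ := h.exists_expSum_add_eq u z
  refine ⟨n, t, by simpa using ht, fun i => ?_⟩
  have h1 : -(t : ℤ) + z = expSum (ψ (vertex u n)) := by omega
  have h2 : expSum ((ψ (vertex u n))⁻¹ * ψ (vertex u (i + n))) - t + z =
      expSum (ψ (vertex u (i + n))) := by
    rw [expSum_mul, expSum_inv]
    omega
  rw [vertex_shift, vertex_shift, vertex_shift, map_mul, map_inv, h1, h2, ← huv, ← huv]
  group

/-- The window of `w` occurs in `φ(l)` for some `l` in the language. As `l` occurs in `v`, the
window occurs in the image of `v`, and a shift brings it to the origin. -/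
theorem language_exists_isImageAt {N : ℕ} {φ : MulAut (F N)} (hpos : IsPositive φ)
    (hprim : IsPrimitive φ) {v : ℤ → Fin N} (hv : v ∈ languageShift φ)
    (hv' : ∀ l ∈ language φ, ∃ i, l = factor v i l.length) {w : ℤ → Fin N}
    (hw : w ∈ languageShift φ) (m : ℕ) :
    ∃ u ∈ languageShift φ, ∃ w' t, IsImageAt φ u w' t ∧ ∀ i : ℤ, -m ≤ i → i < m → w' i = w i := by
  obtain ⟨l, hl, hl'⟩ := language_exists_infix_flatMap hprim hpos (hw (-m) (2 * m))
  obtain ⟨j, hj⟩ := hv' l hl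
  obtain ⟨x, -, hx⟩ := hpos.exists_boundaryMap₂_ends v
  have h1 : ∃ i, factor x i (l.flatMap (image φ)).length = l.flatMap (image φ) := by
    refine ⟨expSum (φ (vertex v j)), posWord_injective ?_⟩
    have h2 := vertex_add_natCast x (expSum (φ (vertex v j))) (l.flatMap (image φ)).length
    have h3 := congrArg φ (vertex_add_natCast v j l.length)
    have h4 := hx (j + l.length)
    rw [h3, ← hj, map_mul, hpos.apply_posWord, expSum_mul, expSum_posWord, h2, ← hx,
      mul_right_inj] at h4
    exact h4.symm
  obtain ⟨i, hi⟩ := h1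
  rw [← hi] at hl'
  obtain ⟨z, hz⟩ := exists_eq_factor hl'
  rw [length_factor] at hz
  obtain ⟨n, t, ht⟩ := hpos.exists_isImageAt_shift hx (z + m)
  refine ⟨_, shift_mem_languageShift hv n, _, t, ht, eq_of_factor_eq hz⟩

theorem exists_isImageAt {N : ℕ} {φ : MulAut (F N)} (hpos : IsPositive φ)
    (hprim : IsPrimitive φ) {v : ℤ → Fin N} (hv : v ∈ languageShift φ)
    (hv' : ∀ l ∈ language φ, ∃ i, l = factor v i l.length) {w : ℤ → Fin N}
    (hw : w ∈ languageShift φ) : ∃ u ∈ languageShift φ, ∃ t, IsImageAt φ u w t := by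
  choose U hU w' T hT hw' using language_exists_isImageAt hpos hprim hv hv' hw
  -- Compactness: the limit along a nonprincipal ultrafilter is taken letter by letter over the
  -- finite alphabet. The offset `t` also takes finitely many values once the letter at 0 has
  -- stabilized, and each image identity involves finitely many letters.
  have h1 : ∀ i, ∃ a, ∀ᶠ m in hyperfilter ℕ, U m i = a := fun i =>
    Ultrafilter.eventually_exists_iff.1 (Eventually.of_forall fun m => ⟨_, rfl⟩)
  choose u hu using h1
  have h2 : ∃ t ∈ Set.Iio (image φ (u 0)).length, ∀ᶠ m in hyperfilter ℕ, T m = t := by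
    rw [← Ultrafilter.eventually_exists_mem_iff (Set.finite_Iio _)]
    filter_upwards [hu 0] with m hm
    exact ⟨_, hm ▸ (hT m).1, rfl⟩
  obtain ⟨t, ht, hTt⟩ := h2
  have hw'' : ∀ i, ∀ᶠ m in hyperfilter ℕ, w' m i = w i := fun i => by
    filter_upwards [Nat.hyperfilter_le_atTop (eventually_gt_atTop i.natAbs)] with m hm
    exact hw' m i (by omega) (by omega)
  have hvertex : ∀ {f : ℕ → ℤ → Fin N} {g : ℤ → Fin N},
      (∀ i, ∀ᶠ m in hyperfilter ℕ, f m i = g i) → ∀ n, ∀ᶠ m in hyperfilter ℕ,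
        vertex (f m) n = vertex g n := fun {f g} h n => by
    filter_upwards [(Finset.eventually_all (Finset.Ico (-|n|) |n|)).2 fun i _ => h i] with m hm
    exact vertex_congr fun j h1 h2 => hm j (Finset.mem_Ico.2 ⟨h1, h2⟩)
  refine ⟨u, fun i n => ?_, t, ht, fun n => ?_⟩
  · obtain ⟨m, hm⟩ :=
      ((Finset.eventually_all (Finset.range n)).2 fun j _ => hu (i + j)).exists
    rw [factor_congr (w' := U m) (i' := i) fun j hj => (hm j (Finset.mem_range.2 hj)).symm]
    exact hU m i n
  · obtain ⟨m, hm1, hm2, hm3, hm4⟩ := ((hvertex hu n).and ((hvertex hw'' (-t)).and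
      ((hvertex hw'' (expSum (φ (vertex u n)) - t)).and hTt))).exists
    have := (hT m).2 n
    rwa [hm4, hm1, hm2, hm3] at this

theorem IsImageAt.exists_cut {N : ℕ} {φ : MulAut (F N)} (hpos : IsPositive φ) {u w : ℤ → Fin N}
    {t : ℕ} (h : IsImageAt φ u w t) : ∃ p s, IsCut (φ (FreeGroup.of (u 0))) p (w 0) s ∧
      ends w = translate₂ p⁻¹ (boundaryMap₂ φ (ends u)) := by
  obtain ⟨ht, h⟩ := h
  obtain ⟨r, hr⟩ : ∃ r, (image φ (u 0)).length = t + 1 + r := ⟨_, (Nat.add_sub_of_le ht).symm⟩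
  refine ⟨posWord (factor w (-t) t), posWord (factor w 1 r), ?_, ?_⟩
  -- The relation at the vertices 0 and 1 identifies `φ(u_0)` with the factor of `w` starting at
  -- `-t`; it contains position 0, which marks the cut.
  · have h1 := h 1
    have h2 : vertex u 1 = FreeGroup.of (u 0) := by simpa using vertex_add_one u 0
    rw [h2, hpos.expSum_apply_of, hpos.apply_of, sub_eq_neg_add, vertex_add_natCast, mul_right_inj,
      hr, factor_add, factor_add, factor_one, Nat.cast_add, Nat.cast_one, ← add_assoc,
      neg_add_cancel, zero_add] at h1
    rw [IsCut, hpos.apply_of, h1, toWord_posWord, toWord_posWord, toWord_posWord]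
    simp
  · rw [eq_comm, hpos.translate₂_boundaryMap₂_eq_iff]
    intro n
    rw [← vertex_neg_natCast, h, expSum_posWord, length_factor]

theorem attractingSubshift_exists_desubstitution {N : ℕ} {φ : MulAut (F N)} (hpos : IsPositive φ)
    (hprim : IsPrimitive φ) {w : ℤ → Fin N} (hw : ends w ∈ attractingSubshift φ) :
    ∃ u p s, ends u ∈ attractingSubshift φ ∧ IsCut (φ (FreeGroup.of (u 0))) p (w 0) s ∧
      ends w = translate₂ p⁻¹ (boundaryMap₂ φ (ends u)) := by
  obtain ⟨w', hw', h⟩ := exists_languageShift_of_mem hpos hprim hw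
  obtain rfl := ends_injective h
  obtain ⟨-, Z, hZ, -⟩ := hw
  obtain ⟨v, hv, -, hv'⟩ := hZ.exists_languageShift hpos hprim
  obtain ⟨u, hu, t, ht⟩ := exists_isImageAt hpos hprim hv hv' hw'
  obtain ⟨p, s, hps⟩ := ht.exists_cut hpos
  exact ⟨u, p, s, ends_mem_attractingSubshift hpos hprim hZ hu, hps⟩

/-! ### Growth -/

theorem mul_length_le_length_flatMap {α β : Type*} {f : α → List β} {c : ℕ}
    (h : ∀ a, c ≤ (f a).length) (l : List α) : l.length * c ≤ (l.flatMap f).length := by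
  induction l with
  | nil => simp
  | cons a l ih =>
    have := h a
    rw [List.flatMap_cons, List.length_append, List.length_cons, Nat.succ_mul]
    omega

/-- Some `φ^K(a)` contains all letters, hence at least two because `N ≥ 2`; each further application
of `φ^K` at least doubles the length bound. -/
theorem IsPrimitive.exists_le_length_image {N : ℕ} (hN : 2 ≤ N) {φ : MulAut (F N)}
    (hprim : IsPrimitive φ) (hpos : IsPositive φ) (m : ℕ) :
    ∃ T, ∀ t, T ≤ t → ∀ a, m ≤ (image (φ ^ t) a).length := by
  obtain ⟨K, hK, h⟩ := hprim.exists_mem_image hpos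
  have h2 : ∀ a, 2 ≤ (image (φ ^ K) a).length := fun a => by
    have h3 : (image (φ ^ K) a).toFinset = Finset.univ := by
      ext b
      simp [h K le_rfl a b]
    have h4 := List.toFinset_card_le (image (φ ^ K) a)
    rw [h3, Finset.card_univ, Fintype.card_fin] at h4
    omega
  suffices h5 : ∃ T, ∀ t, T ≤ t → ∀ a, 2 ^ m ≤ (image (φ ^ t) a).length by
    obtain ⟨T, hT⟩ := h5
    exact ⟨T, fun t ht a => (Nat.lt_two_pow_self (n := m)).le.trans (hT t ht a)⟩
  induction m with
  | zero => exact ⟨0, fun t _ a => (hpos.pow t).image_length_pos a⟩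
  | succ m ih =>
    obtain ⟨T, hT⟩ := ih
    refine ⟨T + K, fun t ht a => ?_⟩
    obtain ⟨t, rfl⟩ := Nat.exists_eq_add_of_le' (show K ≤ t by omega)
    rw [hpos.image_pow_add]
    refine le_trans ?_ (mul_length_le_length_flatMap (hT t (by omega)) _)
    rw [pow_succ, mul_comm]
    exact Nat.mul_le_mul_right _ (h2 a)

/-! ### Chains of desubstitutions -/

/-- The sequence of bi-infinite words `w` is a sequence of desubstitutions with labels `d`. -/
def IsDesubstitution {N : ℕ} (φ : MulAut (F N)) (w : ℕ → ℤ → Fin N) (d : ℕ → Label N) : Prop :=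
  ∀ i, w i 0 = (d i).a ∧ IsCut (φ (FreeGroup.of (w (i + 1) 0))) (d i).p (d i).a (d i).s ∧
    ends (w i) = translate₂ (d i).p⁻¹ (boundaryMap₂ φ (ends (w (i + 1))))

theorem IsDesubstitution.tail {N : ℕ} {φ : MulAut (F N)} {w : ℕ → ℤ → Fin N} {d : ℕ → Label N}
    (h : IsDesubstitution φ w d) (n : ℕ) :
    IsDesubstitution φ (fun i => w (i + n)) (fun i => d (i + n)) := fun i => by
  have := h (i + n)
  rwa [add_right_comm] at this

theorem IsCut.suffix_unique {N : ℕ} {v p s s' : F N} {a : Fin N} (h : IsCut v p a s)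
    (h' : IsCut v p a s') : s = s' := by
  have h1 := h.eq_mul
  rw [h'.eq_mul] at h1
  exact (mul_left_cancel h1).symm

theorem IsDesubstitution.unique {N : ℕ} {φ : MulAut (F N)} (hpos : IsPositive φ)
    {w w' : ℕ → ℤ → Fin N} {d d' : ℕ → Label N} (h : IsDesubstitution φ w d)
    (h' : IsDesubstitution φ w' d') (h0 : w 0 = w' 0) : d = d' := by
  have hw : ∀ i, w i = w' i := fun i => by
    induction i with
    | zero => exact h0
    | succ i ih =>
      have h1 := (h' i).2.2
      rw [← ih] at h1
      exact (hpos.desubstitution_unique (h i).2.2 h1 (h i).2.1 (h' i).2.1).1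
  funext i
  have h1 := h' i
  have h2 := h i
  rw [← hw i, ← hw (i + 1)] at h1
  have hp := (hpos.desubstitution_unique h2.2.2 h1.2.2 h2.2.1 h1.2.1).2
  have ha := h2.1.symm.trans h1.1
  generalize d i = x at h2 hp ha ⊢
  generalize d' i = y at h1 hp ha ⊢
  obtain ⟨p, a, s⟩ := x
  obtain ⟨p', a', s'⟩ := y
  dsimp only at hp ha h1 h2
  subst hp ha
  rw [h2.2.1.suffix_unique h1.2.1]

theorem IsDevelopment.exists_isDesubstitution {N : ℕ} {φ : MulAut (F N)} (hpos : IsPositive φ)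
    (hprim : IsPrimitive φ) {W : Boundary N × Boundary N} {d : ℕ → Label N}
    (h : IsDevelopment φ W d) : ∃ w, W = ends (w 0) ∧ IsDesubstitution φ w d := by
  obtain ⟨hd, Z, rfl, hZ⟩ := h
  choose w hw hw' using fun i => exists_languageShift_of_mem hpos hprim (hZ i).1
  have ha : ∀ i, w i 0 = (d i).a := fun i => by
    have := (hZ i).2.1
    rw [hw', letter_ends_snd] at this
    exact congrArg Prod.fst this
  refine ⟨w, hw' 0, fun i => ⟨ha i, ?_, ?_⟩⟩
  · rw [ha]
    exact hd i
  · rw [← hw', ← hw']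
    exact (hZ i).2.2

theorem exists_isDevelopment {N : ℕ} {φ : MulAut (F N)} (hpos : IsPositive φ)
    (hprim : IsPrimitive φ) {W : Boundary N × Boundary N} (hW : W ∈ attractingSubshift φ) :
    ∃ d, IsDevelopment φ W d := by
  obtain ⟨w, -, rfl⟩ := exists_languageShift_of_mem hpos hprim hW
  choose f p s hf hcut heq using fun x : {w : ℤ → Fin N // ends w ∈ attractingSubshift φ} =>
    attractingSubshift_exists_desubstitution hpos hprim x.2
  let x : ℕ → {w : ℤ → Fin N // ends w ∈ attractingSubshift φ} :=
    Nat.rec ⟨w, hW⟩ fun _ x => ⟨f x, hf x⟩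
  exact ⟨fun i => ⟨p (x i), (x i).1 0, s (x i)⟩, fun i => hcut (x i), fun i => ends (x i).1, rfl,
    fun i => ⟨(x i).2, rfl, heq (x i)⟩⟩

theorem isDevelopment_iff {N : ℕ} {φ : MulAut (F N)} (hpos : IsPositive φ)
    (hprim : IsPrimitive φ) {W : Boundary N × Boundary N} (hW : W ∈ attractingSubshift φ)
    (d : ℕ → Label N) : IsDevelopment φ W d ↔ d = development φ W := by
  have hex := exists_isDevelopment hpos hprim hW
  have hdev : IsDevelopment φ W (development φ W) := by
    rw [development, dif_pos hex]
    exact hex.choose_spec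
  refine ⟨fun h => ?_, fun h => h ▸ hdev⟩
  obtain ⟨w, hw, h1⟩ := h.exists_isDesubstitution hpos hprim
  obtain ⟨w', hw', h2⟩ := hdev.exists_isDesubstitution hpos hprim
  exact h1.unique hpos h2 (ends_injective (hw.symm.trans hw'))

theorem development_exists_isDesubstitution {N : ℕ} {φ : MulAut (F N)} (hpos : IsPositive φ)
    (hprim : IsPrimitive φ) {W : Boundary N × Boundary N} (hW : W ∈ attractingSubshift φ) :
    ∃ w, W = ends (w 0) ∧ IsDesubstitution φ w (development φ W) :=
  ((isDevelopment_iff hpos hprim hW _).2 rfl).exists_isDesubstitution hpos hprim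

/-- The prefix cut by `n` successive desubstitutions. -/
def cutPrefix {N : ℕ} (φ : MulAut (F N)) (d : ℕ → Label N) : ℕ → F N
  | 0 => 1
  | n + 1 => (φ ^ n) (d n).p * cutPrefix φ d n

theorem IsDesubstitution.ends_eq {N : ℕ} {φ : MulAut (F N)} (hpos : IsPositive φ)
    {w : ℕ → ℤ → Fin N} {d : ℕ → Label N} (h : IsDesubstitution φ w d) (n : ℕ) :
    ends (w 0) = translate₂ (cutPrefix φ d n)⁻¹ (boundaryMap₂ (φ ^ n) (ends (w n))) := by
  induction n with
  | zero => rw [cutPrefix, pow_zero, boundaryMap₂_one, inv_one, translate₂_one]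
  | succ n ih =>
    rw [ih, (h n).2.2, boundaryMap₂_translate₂, ← translate₂_mul, cutPrefix, mul_inv_rev, map_inv,
      pow_succ, (hpos.pow n).boundaryMap₂_mul hpos]

/-! ### Fixed points have periodic developments -/

/-- The positive integers `-e n` are nonincreasing, hence constant from their minimum on, and
nothing is left for `x n`. -/
theorem eventually_eq_zero_of_le {e x : ℕ → ℤ} (he : ∀ n, e n < 0) (hx : ∀ n, 0 ≤ x n)
    (h : ∀ n, -e (n + 1) + x n ≤ -e n) : ∃ n, ∀ i, n ≤ i → x i = 0 := by
  have h1 : Antitone fun n => -e n := antitone_nat_of_succ_le fun n => by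
    have := h n
    have := hx n
    omega
  obtain ⟨n, hn⟩ : ∃ n, ∀ i, (-e n).toNat ≤ (-e i).toNat :=
    ⟨Function.argmin fun n => (-e n).toNat,
      fun i => Function.argmin_le (fun n => (-e n).toNat) i⟩
  refine ⟨n, fun i hi => ?_⟩
  have h2 := h1 hi
  have h3 := hn (i + 1)
  have h4 := h i
  have h5 := hx i
  have h6 := he (i + 1)
  have h7 := he i
  dsimp only at h2
  omega

/-- The displacement between the two chains never grows in absolute value and cannot jump across 0.
Reaching 0 makes the chains equal; otherwise it stabilizes, and the estimate leaves no room for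
nonempty suffixes on one side and prefixes on the other. -/
theorem IsDesubstitution.eventually_eq_or {N : ℕ} {φ : MulAut (F N)} (hpos : IsPositive φ)
    {w w' : ℕ → ℤ → Fin N} {d d' : ℕ → Label N} (h : IsDesubstitution φ w d)
    (h' : IsDesubstitution φ w' d') {g : F N} (hg : ends (w' 0) = translate₂ g (ends (w 0))) :
    (∃ n, w n = w' n) ∨ (∃ n, ∀ i, n ≤ i → (d i).s = 1 ∧ (d' i).p = 1) ∨
      ∃ n, ∀ i, n ≤ i → (d' i).s = 1 ∧ (d i).p = 1 := by
  let G : ℕ → F N := Nat.rec g fun n x => φ⁻¹ ((d' n).p * x * (d n).p⁻¹)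
  have hG' : ∀ n, φ (G (n + 1)) = (d' n).p * G n * (d n).p⁻¹ := fun n =>
    MulAut.apply_inv_self _ _ _
  have hG : ∀ n, ends (w' n) = translate₂ (G n) (ends (w n)) := fun n => by
    induction n with
    | zero => exact hg
    | succ n ih =>
      obtain ⟨k, hk, hk', -⟩ :=
        hpos.exists_desubstitution_translate (h n).2.2 (h' n).2.2 (h n).2.1 ih
      rwa [φ.injective (hk'.trans (hG' n).symm)] at hk
  have hneg : ∀ n, expSum (G (n + 1)) < 0 →
      -expSum (G (n + 1)) + expSum (d n).s + expSum (d' n).p ≤ -expSum (G n) := fun n hn => by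
    obtain ⟨k, -, hk', h1⟩ :=
      hpos.exists_desubstitution_translate (h n).2.2 (h' n).2.2 (h n).2.1 (hG n)
    rw [φ.injective (hk'.trans (hG' n).symm)] at h1
    exact h1 hn
  have hpos' : ∀ n, 0 < expSum (G (n + 1)) →
      expSum (G (n + 1)) + expSum (d' n).s + expSum (d n).p ≤ expSum (G n) := fun n hn => by
    -- The opposite sign is handled by exchanging the two chains and inverting the translation.
    obtain ⟨k, -, hk', h1⟩ :=
      hpos.exists_desubstitution_translate (h' n).2.2 (h n).2.2 (h' n).2.1
        (g := (G n)⁻¹) (by rw [eq_comm, translate₂_inv_eq_iff, hG])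
    have h2 : k = (G (n + 1))⁻¹ := by
      apply φ.injective
      rw [hk', map_inv, hG']
      group
    rw [h2, expSum_inv, expSum_inv, neg_neg, neg_neg] at h1
    exact h1 (by omega)
  have hd := fun n => (h n).2.1.expSum_nonneg hpos
  have hd' := fun n => (h' n).2.1.expSum_nonneg hpos
  have hone := fun n => (h n).2.1.eq_one hpos
  have hone' := fun n => (h' n).2.1.eq_one hpos
  by_cases h0 : ∃ n, expSum (G n) = 0
  · obtain ⟨n, hn⟩ := h0
    refine Or.inl ⟨n, ?_⟩
    have h1 := translate₂_ends_eq_iff.1 (hG n).symm 0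
    rw [hn, zero_add, vertex_zero, vertex_zero, mul_one] at h1
    have h2 := hG n
    rw [h1, translate₂_one] at h2
    exact (ends_injective h2).symm
  push Not at h0
  right
  rcases lt_or_gt_of_ne (h0 0) with h1 | h1
  · left
    have h2 : ∀ n, expSum (G n) < 0 := fun n => by
      induction n with
      | zero => exact h1
      | succ n ih =>
        by_contra h3
        have h4 := hpos' n (by have := h0 (n + 1); omega)
        have h5 := hd n
        have h6 := hd' n
        omega
    obtain ⟨n, hn⟩ := eventually_eq_zero_of_le
      (x := fun n => expSum (d n).s + expSum (d' n).p) h2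
      (fun n => add_nonneg (hd n).2 (hd' n).1)
      (fun n => by have := hneg n (h2 (n + 1)); omega)
    refine ⟨n, fun i hi => ?_⟩
    have h3 := hn i hi
    have h4 := hd i
    have h5 := hd' i
    exact ⟨(hone i).2 (by omega), (hone' i).1 (by omega)⟩
  · right
    have h2 : ∀ n, -expSum (G n) < 0 := fun n => by
      induction n with
      | zero => omega
      | succ n ih =>
        by_contra h3
        have h4 := hneg n (by have := h0 (n + 1); omega)
        have h5 := hd n
        have h6 := hd' n
        omega
    obtain ⟨n, hn⟩ := eventually_eq_zero_of_le
      (x := fun n => expSum (d' n).s + expSum (d n).p) h2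
      (fun n => add_nonneg (hd' n).2 (hd n).1)
      (fun n => by have := hpos' n (by have := h2 (n + 1); omega); omega)
    refine ⟨n, fun i hi => ?_⟩
    have h3 := hn i hi
    have h4 := hd i
    have h5 := hd' i
    exact ⟨(hone' i).2 (by omega), (hone i).1 (by omega)⟩

/-- Empty prefixes and suffixes mean `φ(a_{i+1}) = a_i`, so arbitrarily high powers of φ would send
a letter to a letter. -/
theorem IsDesubstitution.not_eventually_eq_one {N : ℕ} (hN : 2 ≤ N) {φ : MulAut (F N)}
    (hpos : IsPositive φ) (hprim : IsPrimitive φ) {w : ℕ → ℤ → Fin N} {d : ℕ → Label N}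
    (h : IsDesubstitution φ w d) (n : ℕ) :
    ¬ ∀ i, n ≤ i → (d i).s = 1 ∧ (d i).p = 1 := by
  intro h1
  have h2 : ∀ j, (φ ^ j) (FreeGroup.of (w (n + j) 0)) = FreeGroup.of (w n 0) := fun j => by
    induction j with
    | zero => rfl
    | succ j ih =>
      have h3 := (h (n + j)).2.1.eq_mul
      rw [(h1 (n + j) (by omega)).1, (h1 (n + j) (by omega)).2, one_mul, mul_one,
        ← (h (n + j)).1] at h3
      rw [pow_succ, MulAut.mul_apply, ← add_assoc, h3, ih]
  obtain ⟨T, hT⟩ := hprim.exists_le_length_image hN hpos 2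
  have h3 := hT T le_rfl (w (n + T) 0)
  rw [image, h2, FreeGroup.toWord_of] at h3
  simp at h3

theorem isPreperiodic_development {N : ℕ} (hN : 2 ≤ N) {φ : MulAut (F N)}
    (hpos : IsPositive φ) (hprim : IsPrimitive φ) {W : Boundary N × Boundary N}
    (hW : W ∈ attractingSubshift φ) (v : F N) {k : ℕ} (hk : 1 ≤ k)
    (hfix : boundaryMap₂ (innerAut v * φ ^ k) W = W) : IsPreperiodic (development φ W) k := by
  obtain ⟨w, hw, h⟩ := development_exists_isDesubstitution hpos hprim hW
  generalize development φ W = d at h ⊢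
  subst hw
  refine ⟨hk, ?_⟩
  rw [boundaryMap₂_innerAut_mul, translate₂_inv_eq_iff] at hfix
  have h1 := h.ends_eq hpos k
  have h2 : boundaryMap₂ (φ ^ k) (ends (w 0)) =
      translate₂ (v * (cutPrefix φ d k)⁻¹) (boundaryMap₂ (φ ^ k) (ends (w k))) := by
    rw [hfix, translate₂_mul, ← h1]
  have h3 := (hpos.pow k).ends_eq_translate₂ h2
  -- The chain is compared with its own tail, since `w 0` is a translate of `w k`. If the chains
  -- merge, the labels agree up to a shift by `k`. Otherwise one chain loses its suffixes and the
  -- other its prefixes; both being tails of one chain, all late labels have empty `p` and `s`.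
  rcases (h.tail k).eventually_eq_or hpos h (by simpa using h3) with
    ⟨n, hn⟩ | ⟨n, hn⟩ | ⟨n, hn⟩
  · refine ⟨n, fun i hi => ?_⟩
    obtain ⟨j, rfl⟩ := Nat.exists_eq_add_of_le' hi
    have h4 := (h.tail (n + k)).unique hpos (h.tail n) (by simpa using hn)
    simpa [add_assoc] using congrFun h4 j
  · refine absurd (fun i hi => ?_) (h.not_eventually_eq_one hN hpos hprim (n + k))
    obtain ⟨j, rfl⟩ := Nat.exists_eq_add_of_le' (show k ≤ i by omega)
    exact ⟨(hn j (by omega)).1, (hn (j + k) (by omega)).2⟩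
  · refine absurd (fun i hi => ?_) (h.not_eventually_eq_one hN hpos hprim (n + k))
    obtain ⟨j, rfl⟩ := Nat.exists_eq_add_of_le' (show k ≤ i by omega)
    exact ⟨(hn (j + k) (by omega)).1, (hn j (by omega)).2⟩

/-! ### Eventually constant developments -/

theorem eq_of_vertex_eq_vertex {N : ℕ} {w w' : ℤ → Fin N} {m n i : ℤ}
    (hm : vertex w m = vertex w' m) (hn : vertex w n = vertex w' n) (h1 : m ≤ i) (h2 : i < n) :
    w i = w' i := by
  obtain ⟨k, rfl⟩ : ∃ k : ℕ, n = m + k := ⟨(n - m).toNat, by omega⟩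
  rw [vertex_add_natCast, vertex_add_natCast, hm, mul_right_inj] at hn
  have h3 := factor_eq_iff.1 (posWord_injective hn) (i - m).toNat (by omega)
  rwa [Int.toNat_of_nonneg (by omega), add_sub_cancel] at h3

/-- If `p` or `s` is empty, the images of the central letter alone may cover only one side of the
origin. The images under `φ^t` of the three letters at -1, 0, 1 always cover a window that grows on
both sides. -/
theorem IsDesubstitution.eq_of_const {N : ℕ} (hN : 2 ≤ N) {φ : MulAut (F N)}
    (hpos : IsPositive φ) (hprim : IsPrimitive φ) {w w' : ℕ → ℤ → Fin N} {c : Label N}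
    (h : IsDesubstitution φ w fun _ => c) (h' : IsDesubstitution φ w' fun _ => c)
    (hfreq : ∃ᶠ t in atTop, w t (-1) = w' t (-1) ∧ w t 1 = w' t 1) : w 0 = w' 0 := by
  have hc := (h 0).2.1
  rw [(h 1).1] at hc
  -- The origin of `w 0` stays within, or at an end of, the block `φ^t(a)`, so the neighbouring
  -- blocks lie on either side of it.
  have hQ : ∀ t, 0 ≤ expSum (cutPrefix φ (fun _ => c) t) ∧
      expSum (cutPrefix φ (fun _ => c) t) ≤ expSum ((φ ^ t) (FreeGroup.of c.a)) := fun t => by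
    induction t with
    | zero => simp [cutPrefix]
    | succ t ih =>
      obtain ⟨l, r, hl, hr, -⟩ := hc.image_eq hpos
      have h1 := (hpos.pow t).natCast_le_expSum l
      have h2 := (hpos.pow t).natCast_le_expSum r
      rw [cutPrefix, pow_succ, MulAut.mul_apply, hc.eq_mul, hl, hr]
      simp only [map_mul, expSum_mul]
      omega
  funext i
  obtain ⟨T, hT⟩ := hprim.exists_le_length_image hN hpos (i.natAbs + 1)
  obtain ⟨t, ⟨ht1, ht2⟩, hTt⟩ := (hfreq.and_eventually (eventually_ge_atTop T)).exists
  have e1 := (hpos.pow t).translate₂_boundaryMap₂_eq_iff.1 (h.ends_eq hpos t).symm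
  have e2 := (hpos.pow t).translate₂_boundaryMap₂_eq_iff.1 (h'.ends_eq hpos t).symm
  have h0 : w t 0 = w' t 0 := (h t).1.trans (h' t).1.symm
  have hv2 : ∀ u : ℤ → Fin N, vertex u 2 = FreeGroup.of (u 0) * FreeGroup.of (u 1) := fun u => by
    rw [show (2 : ℤ) = 0 + 1 + 1 by norm_num, vertex_add_one, vertex_add_one]
    simp
  have hv1 : ∀ u : ℤ → Fin N, vertex u (-1) = (FreeGroup.of (u (-1)))⁻¹ := fun u => by
    have h2 := vertex_add_one u (-1)
    rw [neg_add_cancel, vertex_zero] at h2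
    exact eq_inv_of_mul_eq_one_left h2.symm
  have f1 := e1 2
  have f2 := e1 (-1)
  have g1 := e2 2
  have g2 := e2 (-1)
  rw [hv2] at f1 g1
  rw [hv1] at f2 g2
  rw [← h0, ← ht2, f1] at g1
  rw [← ht1, f2] at g2
  have hq := hQ t
  have hT1 := hT t hTt (w t (-1))
  have hT2 := hT t hTt (w t 1)
  rw [← (h t).1] at hq
  refine eq_of_vertex_eq_vertex g2 g1 ?_ ?_
  · rw [map_inv, expSum_inv, (hpos.pow t).expSum_apply_of]
    omega
  · rw [map_mul, expSum_mul, (hpos.pow t).expSum_apply_of (w t 1)]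
    omega

/-- At each time `t`, two of `card C + 1` consecutive values agree. Only finitely many pairs of
offsets are available, so one of them recurs infinitely often. -/
theorem exists_ne_frequently_eq {C : Type*} [Finite C] (f : ℕ → C) :
    ∃ i j : ℕ, i < j ∧ ∃ᶠ t in atTop, f (t + i) = f (t + j) := by
  cases nonempty_fintype C
  by_contra! h
  have h1 : ∀ᶠ t in atTop, ∀ i j : Fin (Fintype.card C + 1), i < j → f (t + i) ≠ f (t + j) := by
    simp only [eventually_all]
    intro i j hij
    exact h i j hij
  obtain ⟨t, ht⟩ := h1.exists
  obtain ⟨i, j, hij, h2⟩ := Fintype.exists_ne_map_eq_of_card_lt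
    (fun i : Fin (Fintype.card C + 1) => f (t + i)) (by simp)
  rcases lt_or_gt_of_ne hij with h3 | h3
  · exact ht i j h3 h2
  · exact ht j i h3 h2.symm

theorem exists_boundaryMap₂_eq_of_isEventuallyConstant {N : ℕ} (hN : 2 ≤ N) {φ : MulAut (F N)}
    (hpos : IsPositive φ) (hprim : IsPrimitive φ) {W : Boundary N × Boundary N}
    (hW : W ∈ attractingSubshift φ) (hconst : IsEventuallyConstant (development φ W)) :
    ∃ ψ ∈ outerPowers φ, boundaryMap₂ ψ W = W := by
  obtain ⟨w, hw, h⟩ := development_exists_isDesubstitution hpos hprim hW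
  generalize development φ W = d at h hconst
  subst hw
  obtain ⟨n, c, hc⟩ := hconst
  have hconst : ∀ m, n ≤ m → IsDesubstitution φ (fun i => w (i + m)) fun _ => c := fun m hm => by
    have := h.tail m
    rwa [show (fun i => d (i + m)) = fun _ => c from funext fun i => hc _ (by omega)] at this
  -- The letter at 0 is already fixed by the label; only its two neighbours have to be matched.
  obtain ⟨i, j, hij, hfreq⟩ := exists_ne_frequently_eq fun t => (w (t + n) (-1), w (t + n) 1)
  have hw : w (i + n) = w (j + n) := by
    have := (hconst (i + n) (by omega)).eq_of_const hN hpos hprim (hconst (j + n) (by omega))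
      (hfreq.mono fun t ht => by
        simpa only [add_assoc, Prod.mk.injEq] using ht)
    simpa using this
  obtain ⟨k, rfl⟩ := Nat.exists_eq_add_of_lt hij
  set m := i + n
  set K := k + 1
  have h1 := h.ends_eq hpos m
  have h2 := (h.tail m).ends_eq hpos K
  rw [show K + m = i + k + 1 + n by omega, zero_add, ← hw] at h2
  set r := cutPrefix φ d m
  set q := cutPrefix φ (fun i => d (i + m)) K
  rw [eq_comm, translate₂_inv_eq_iff] at h1 h2
  -- Since `φ^K(w_m) = q w_m` and `φ^m(w_m) = r W`, commuting the two powers gives `φ^K(rW) = φ^m(q)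
  -- r W`. Solving for `φ^K(W)` yields the conjugating element used below.
  have h3 : boundaryMap₂ (φ ^ K) (boundaryMap₂ (φ ^ m) (ends (w m))) =
      translate₂ ((φ ^ m) q * r) (ends (w 0)) := by
    rw [← (hpos.pow K).boundaryMap₂_mul (hpos.pow m), ← pow_add, add_comm, pow_add,
      (hpos.pow m).boundaryMap₂_mul (hpos.pow K), h2, boundaryMap₂_translate₂, h1, translate₂_mul]
  rw [h1, boundaryMap₂_translate₂, eq_comm, ← translate₂_inv_eq_iff, ← translate₂_mul] at h3
  refine ⟨_, ⟨((φ ^ K) r)⁻¹ * ((φ ^ m) q * r), K, by omega, rfl⟩, ?_⟩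
  rw [boundaryMap₂_innerAut_mul, translate₂_inv_eq_iff, h3]

end FreeGroupDev

theorem mainTheorem10 (N : ℕ) (hN : 2 ≤ N) (φ : MulAut (FreeGroupDev.F N))
    (hpos : FreeGroupDev.IsPositive φ) (hprim : FreeGroupDev.IsPrimitive φ) :
    (∀ W ∈ FreeGroupDev.attractingSubshift φ, ∀ d : ℕ → FreeGroupDev.Label N,
      FreeGroupDev.IsDevelopment φ W d ↔ d = FreeGroupDev.development φ W) ∧
    (∀ W ∈ FreeGroupDev.attractingSubshift φ, ∀ (w : FreeGroupDev.F N) (k : ℕ), 1 ≤ k →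
      FreeGroupDev.boundaryMap₂ (FreeGroupDev.innerAut w * φ ^ k) W = W →
      ∃ ℓ ≤ k, FreeGroupDev.IsPreperiodic (FreeGroupDev.development φ W) ℓ) ∧
    (∀ W ∈ FreeGroupDev.attractingSubshift φ,
      FreeGroupDev.IsEventuallyConstant (FreeGroupDev.development φ W) →
      ∃ ψ ∈ FreeGroupDev.outerPowers φ, FreeGroupDev.boundaryMap₂ ψ W = W) := by
  exact
  ⟨fun _ hW d => FreeGroupDev.isDevelopment_iff hpos hprim hW d,
    fun _ hW w k hk hfix =>
      ⟨k, le_rfl, FreeGroupDev.isPreperiodic_development hN hpos hprim hW w hk hfix⟩,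
    fun _ hW h =>
      FreeGroupDev.exists_boundaryMap₂_eq_of_isEventuallyConstant hN hpos hprim hW h⟩
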